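/- A \emph{fusion ring} with finite basis $\{b_i\}_{i\in I}$ is given by structure constants $N_{i,j}^k\in\mathbb Z_{\ge 0}$, $b_ib_j=\sum_k N_{i,j}^k b_k$, a distinguished index $1\in I$ and a map $i\mapsto i^*$ on $I$ such that the product is associative, $b_1$ is neutral, $N_{i,k}^1=N_{k,i}^1=\delta_{i^*,k}$, and $N_{i,j}^k=N_{i^*,k}^j=N_{k,j^*}^i$. A table $(\lambda_{i,s})_{i\in I,\,s\in S}$ of complex numbers is an \emph{eigentable} of a commutative fusion ring if there is a basis $(v_s)_{s\in S}$ of $\mathbb C^I$ with $M_iv_s=\lambda_{i,s}v_s$ for all $i,s$, where $M_i=(N_{i,j}^k)_{k,j}$. Let $\zeta_n=\exp(2\pi \mathrm{i}/n)$, and let $q\ge 2$ be an integer. Let $T_q$ be the following table, where each row (resp. column) group is indexed by a parameter $c$ (resp. $k$) running over the displayed set (empty if the upper bound is $0$). If $q$ is even: $$\begin{array}{|c||c|c|c|c|}\hline c\backslash k&\{1\}&\{1\}&\{1,\dots,\frac{q-2}2\}&\{1,\dots,\frac q2\}\\\hline\hline \{1\}&1&1&1&1\\ \{1,\dots,\frac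 q2\}&q-1&-1&0&-\zeta_{q+1}^{kc}-\zeta_{q+1}^{-kc}\\ \{1\}&q&0&1&-1\\ \{1,\dots,\frac{q-2}2\}&q+1&1&\zeta_{q-1}^{kc}+\zeta_{q-1}^{-kc}&0\\\hline\end{array}$$ If $q\equiv-1 \bmod 4$: $$\begin{array}{|c||c|c|c|c|c|}\hline c\backslash k&\{1\}&\{1,2\}&\{1,\dots,\frac{q-3}4\}&\{1,\dots,\frac{q-3}4\}&\{\frac{q+1}4\}\\\hline\hline \{1\}&1&1&1&1&1\\ \{1,2\}&\frac{q-1}2&\frac{-1+\mathrm{i}(-1)^{k+c}\sqrt q}2&0&(-1)^{k+1}&(-1)^{k+1}\\ \{1,\dots,\frac{q-3}4\}&q-1&-1&0&-\zeta_{q+1}^{2kc}-\zeta_{q+1}^{-2kc}&-2(-1)^c\\ \{1\}&q&0&1&-1&-1\\ \{1,\dots,\frac{q-3}4\}&q+1&1&\zeta_{q-1}^{2kc}+\zeta_{q-1}^{-2kc}&0&0\\\hline\end{array}$$ If $q\equiv 1 \bmod 4$: $$\begin{array}{|c||c|c|c|c|c|}\hline c\backslash k&\{1\}&\{1,2\}&\{1,\dots,\frac{q-5}4\}&\{\frac{q-1}4\}&\{1,\dots,\frac{q-1}4\}\\\hline\hline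 \{1\}&1&1&1&1&1\\ \{1,2\}&\frac{q+1}2&\frac{1+(-1)^{k+c}\sqrt q}2&(-1)^k&(-1)^k&0\\ \{1,\dots,\frac{q-1}4\}&q-1&-1&0&0&-\zeta_{q+1}^{2kc}-\zeta_{q+1}^{-2kc}\\ \{1\}&q&0&1&1&-1\\ \{1,\dots,\frac{q-5}4\}&q+1&1&\zeta_{q-1}^{2kc}+\zeta_{q-1}^{-2kc}&2(-1)^c&0\\\hline\end{array}$$ (When $q$ is a prime power, $T_q$ is the character table of $\mathrm{PSL}(2,q)$.) \textbf{Proposition.} For every integer $q\ge 2$ there is exactly one fusion ring with basis indexed by the rows of $T_q$ whose eigentable is $T_q$; call it the interpolated fusion ring $\mathcal R_q$. It passes the one spectrum criterion, that is, there are no basis indices $i_0,i_1,\dots,i_9$ of $\mathcal R_q$ for which all of the following hold: \begin{align*} &N_{i_4,i_1}^{i_6},\ N_{i_5,i_4}^{i_2},\ N_{i_5,i_6}^{i_3},\ N_{i_7,i_9}^{i_1},\ N_{i_2,i_7}^{i_8},\ N_{i_8,i_9}^{i_3}\neq 0,\\ &\sum_k N_{i_4,i_7}^kN_{i_5^*,i_8}^kN_{i_6,i_9^*}^k=1,\\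 &N_{i_4,i_7}^{i_0}=N_{i_5^*,i_8}^{i_0}=N_{i_6,i_9^*}^{i_0}=1,\\ &N_{i_2,i_1}^{i_3}=0,\\ &\sum_kN_{i_5,i_4}^kN_{i_8,i_7^*}^k=1\ \text{ or }\ \sum_kN_{i_2,i_4^*}^kN_{i_8,i_0^*}^k=1\ \text{ or }\ \sum_kN_{i_5^*,i_2}^kN_{i_0,i_7^*}^k=1,\\ &\sum_kN_{i_5,i_0}^kN_{i_3,i_9^*}^k=1\ \text{ or }\ \sum_kN_{i_8,i_0^*}^kN_{i_3,i_6^*}^k=1\ \text{ or }\ \sum_kN_{i_5^*,i_8}^kN_{i_6,i_9^*}^k=1,\\ &\sum_kN_{i_4,i_7}^kN_{i_6,i_9^*}^k=1\ \text{ or }\ \sum_kN_{i_0,i_7^*}^kN_{i_6,i_1^*}^k=1\ \text{ or }\ \sum_kN_{i_4^*,i_0}^kN_{i_1,i_9^*}^k=1. \end{align*} -/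

import Mathlib

/-- A fusion ring whose basis is indexed by the finite type `ι`: nonnegative integer structure
constants `N i j k` (the coefficient of `b k` in `b i * b j`), a neutral basis element and a duality
on the basis, subject to associativity, neutrality, duality and Frobenius reciprocity. -/
structure FusionRing (ι : Type*) [Fintype ι] [DecidableEq ι] where
  N : ι → ι → ι → ℕ
  one : ι
  dual : ι → ι
  assoc : ∀ i j k l, ∑ m, N i j m * N m k l = ∑ m, N j k m * N i m l
  one_mul : ∀ i k, N one i k = if k = i then 1 else 0
  mul_one : ∀ i k, N i one k = if k = i then 1 else 0
  dual_right : ∀ i k, N i k one = if k = dual i then 1 else 0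
  dual_left : ∀ i k, N k i one = if k = dual i then 1 else 0
  frobenius_left : ∀ i j k, N i j k = N (dual i) k j
  frobenius_right : ∀ i j k, N i j k = N k (dual j) i

namespace FusionRing

variable {ι : Type*} [Fintype ι] [DecidableEq ι] (F : FusionRing ι)

/-- The fusion ring is commutative. -/
def IsCommutative : Prop := ∀ i j k, F.N i j k = F.N j i k

/-- The fusion matrix of the basis element `i`: left multiplication by `b i`, with entry `N i j k` in
row `k` and column `j`. -/
def fusionMatrix (i : ι) : Matrix ι ι ℂ := Matrix.of fun k j => (F.N i j k : ℂ)

/-- The table `T` (rows indexed by the basis, columns by `κ`) is an eigentable of the commutative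
fusion ring `F`: in some basis `v` of `ℂ ^ ι` indexed by `κ`, all fusion matrices are simultaneously
diagonal, the one of `i` being `diag (T i s)`. -/
def IsEigentable {κ : Type*} (T : ι → κ → ℂ) : Prop :=
  F.IsCommutative ∧
    ∃ v : Module.Basis κ ℂ (ι → ℂ), ∀ i s, (F.fusionMatrix i).mulVec (v s) = T i s • v s

/-- The sum `∑ k, N a b k * N c d k`, used in the last three conditions of the one spectrum
criterion. -/
def pairSum (a b c d : ι) : ℕ := ∑ k, F.N a b k * F.N c d k

/-- The system of conditions of the one spectrum criterion, for the indices `i₀, …, i₉`. -/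
def OneSpectrumSystem (i₀ i₁ i₂ i₃ i₄ i₅ i₆ i₇ i₈ i₉ : ι) : Prop :=
  (F.N i₄ i₁ i₆ ≠ 0 ∧ F.N i₅ i₄ i₂ ≠ 0 ∧ F.N i₅ i₆ i₃ ≠ 0 ∧
    F.N i₇ i₉ i₁ ≠ 0 ∧ F.N i₂ i₇ i₈ ≠ 0 ∧ F.N i₈ i₉ i₃ ≠ 0) ∧
  (∑ k, F.N i₄ i₇ k * F.N (F.dual i₅) i₈ k * F.N i₆ (F.dual i₉) k = 1) ∧
  (F.N i₄ i₇ i₀ = 1 ∧ F.N (F.dual i₅) i₈ i₀ = 1 ∧ F.N i₆ (F.dual i₉) i₀ = 1) ∧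
  F.N i₂ i₁ i₃ = 0 ∧
  (F.pairSum i₅ i₄ i₈ (F.dual i₇) = 1 ∨
    F.pairSum i₂ (F.dual i₄) i₈ (F.dual i₀) = 1 ∨
    F.pairSum (F.dual i₅) i₂ i₀ (F.dual i₇) = 1) ∧
  (F.pairSum i₅ i₀ i₃ (F.dual i₉) = 1 ∨
    F.pairSum i₈ (F.dual i₀) i₃ (F.dual i₆) = 1 ∨
    F.pairSum (F.dual i₅) i₈ i₆ (F.dual i₉) = 1) ∧
  (F.pairSum i₄ i₇ i₆ (F.dual i₉) = 1 ∨
    F.pairSum i₀ (F.dual i₇) i₆ (F.dual i₁) = 1 ∨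
    F.pairSum (F.dual i₄) i₀ i₁ (F.dual i₉) = 1)

/-- The fusion ring passes the one spectrum criterion: no ten indices satisfy the system. -/
def PassesOneSpectrumCriterion : Prop :=
  ∀ i₀ i₁ i₂ i₃ i₄ i₅ i₆ i₇ i₈ i₉ : ι, ¬ F.OneSpectrumSystem i₀ i₁ i₂ i₃ i₄ i₅ i₆ i₇ i₈ i₉

end FusionRing

/-- A finite formal table of complex numbers. -/
structure FormalTable where
  Row : Type
  Col : Type
  [fintypeRow : Fintype Row]
  [decidableEqRow : DecidableEq Row]
  [fintypeCol : Fintype Col]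
  entry : Row → Col → ℂ

attribute [instance] FormalTable.fintypeRow FormalTable.decidableEqRow FormalTable.fintypeCol

namespace InterpolatedPSL2

/-- The root of unity `ζ_n = exp (2 π i / n)`. -/
noncomputable def zeta (n : ℕ) : ℂ := Complex.exp (2 * Real.pi * Complex.I / n)

/-- `ζ_n ^ m + ζ_n ^ (-m)`. -/
noncomputable def zetaSum (n m : ℕ) : ℂ := zeta n ^ m + (zeta n ^ m)⁻¹

/-! The rows and columns of each table come in groups, in the order of the table; a group is indexed
by its parameter (`c` for rows, `k` for columns). -/

/-! ### `q` even -/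

/-- Rows of degrees `1`, `q - 1`, `q`, `q + 1`. -/
abbrev EvenRow (q : ℕ) : Type :=
  Unit ⊕ Finset.Icc 1 (q / 2) ⊕ Unit ⊕ Finset.Icc 1 ((q - 2) / 2)

/-- Columns of class sizes `1`, `q² - 1`, `q (q + 1)`, `q (q - 1)`. -/
abbrev EvenCol (q : ℕ) : Type :=
  Unit ⊕ Unit ⊕ Finset.Icc 1 ((q - 2) / 2) ⊕ Finset.Icc 1 (q / 2)

noncomputable def evenEntry (q : ℕ) : EvenRow q → EvenCol q → ℂ
  -- degree `1`
  | .inl _, _ => 1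
  -- degree `q - 1`
  | .inr (.inl _), .inl _ => q - 1
  | .inr (.inl _), .inr (.inl _) => -1
  | .inr (.inl _), .inr (.inr (.inl _)) => 0
  | .inr (.inl c), .inr (.inr (.inr k)) => -zetaSum (q + 1) (k * c)
  -- degree `q`
  | .inr (.inr (.inl _)), .inl _ => q
  | .inr (.inr (.inl _)), .inr (.inl _) => 0
  | .inr (.inr (.inl _)), .inr (.inr (.inl _)) => 1
  | .inr (.inr (.inl _)), .inr (.inr (.inr _)) => -1
  -- degree `q + 1`
  | .inr (.inr (.inr _)), .inl _ => q + 1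
  | .inr (.inr (.inr _)), .inr (.inl _) => 1
  | .inr (.inr (.inr c)), .inr (.inr (.inl k)) => zetaSum (q - 1) (k * c)
  | .inr (.inr (.inr _)), .inr (.inr (.inr _)) => 0

noncomputable def evenTable (q : ℕ) : FormalTable where
  Row := EvenRow q
  Col := EvenCol q
  entry := evenEntry q

/-! ### `q ≡ -1 mod 4` -/

/-- Rows of degrees `1`, `(q - 1) / 2`, `q - 1`, `q`, `q + 1`. -/
abbrev ThreeRow (q : ℕ) : Type :=
  Unit ⊕ Finset.Icc 1 2 ⊕ Finset.Icc 1 ((q - 3) / 4) ⊕ Unit ⊕ Finset.Icc 1 ((q - 3) / 4)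

/-- Columns of class sizes `1`, `(q² - 1) / 2`, `q (q + 1)`, `q (q - 1)`, `q (q - 1) / 2`. -/
abbrev ThreeCol (q : ℕ) : Type :=
  Unit ⊕ Finset.Icc 1 2 ⊕ Finset.Icc 1 ((q - 3) / 4) ⊕ Finset.Icc 1 ((q - 3) / 4) ⊕ Unit

/-- In the last column the class parameter is `k = (q + 1) / 4`. -/
noncomputable def threeEntry (q : ℕ) : ThreeRow q → ThreeCol q → ℂ
  -- degree `1`
  | .inl _, _ => 1
  -- degree `(q - 1) / 2`
  | .inr (.inl _), .inl _ => (q - 1) / 2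
  | .inr (.inl c), .inr (.inl k) =>
      (-1 + Complex.I * (-1) ^ ((k : ℕ) + (c : ℕ)) * (Real.sqrt q : ℂ)) / 2
  | .inr (.inl _), .inr (.inr (.inl _)) => 0
  | .inr (.inl _), .inr (.inr (.inr (.inl k))) => (-1) ^ ((k : ℕ) + 1)
  | .inr (.inl _), .inr (.inr (.inr (.inr _))) => (-1) ^ ((q + 1) / 4 + 1)
  -- degree `q - 1`
  | .inr (.inr (.inl _)), .inl _ => q - 1
  | .inr (.inr (.inl _)), .inr (.inl _) => -1
  | .inr (.inr (.inl _)), .inr (.inr (.inl _)) => 0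
  | .inr (.inr (.inl c)), .inr (.inr (.inr (.inl k))) => -zetaSum (q + 1) (2 * k * c)
  | .inr (.inr (.inl c)), .inr (.inr (.inr (.inr _))) => -2 * (-1) ^ (c : ℕ)
  -- degree `q`
  | .inr (.inr (.inr (.inl _))), .inl _ => q
  | .inr (.inr (.inr (.inl _))), .inr (.inl _) => 0
  | .inr (.inr (.inr (.inl _))), .inr (.inr (.inl _)) => 1
  | .inr (.inr (.inr (.inl _))), .inr (.inr (.inr (.inl _))) => -1
  | .inr (.inr (.inr (.inl _))), .inr (.inr (.inr (.inr _))) => -1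
  -- degree `q + 1`
  | .inr (.inr (.inr (.inr _))), .inl _ => q + 1
  | .inr (.inr (.inr (.inr _))), .inr (.inl _) => 1
  | .inr (.inr (.inr (.inr c))), .inr (.inr (.inl k)) => zetaSum (q - 1) (2 * k * c)
  | .inr (.inr (.inr (.inr _))), .inr (.inr (.inr (.inl _))) => 0
  | .inr (.inr (.inr (.inr _))), .inr (.inr (.inr (.inr _))) => 0

noncomputable def threeTable (q : ℕ) : FormalTable where
  Row := ThreeRow q
  Col := ThreeCol q
  entry := threeEntry q

/-! ### `q ≡ 1 mod 4` -/

/-- Rows of degrees `1`, `(q + 1) / 2`, `q - 1`, `q`, `q + 1`. -/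
abbrev OneRow (q : ℕ) : Type :=
  Unit ⊕ Finset.Icc 1 2 ⊕ Finset.Icc 1 ((q - 1) / 4) ⊕ Unit ⊕ Finset.Icc 1 ((q - 5) / 4)

/-- Columns of class sizes `1`, `(q² - 1) / 2`, `q (q + 1)`, `q (q + 1) / 2`, `q (q - 1)`. -/
abbrev OneCol (q : ℕ) : Type :=
  Unit ⊕ Finset.Icc 1 2 ⊕ Finset.Icc 1 ((q - 5) / 4) ⊕ Unit ⊕ Finset.Icc 1 ((q - 1) / 4)

/-- In the fourth column the class parameter is `k = (q - 1) / 4`. -/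
noncomputable def oneEntry (q : ℕ) : OneRow q → OneCol q → ℂ
  -- degree `1`
  | .inl _, _ => 1
  -- degree `(q + 1) / 2`
  | .inr (.inl _), .inl _ => (q + 1) / 2
  | .inr (.inl c), .inr (.inl k) =>
      (1 + (-1) ^ ((k : ℕ) + (c : ℕ)) * (Real.sqrt q : ℂ)) / 2
  | .inr (.inl _), .inr (.inr (.inl k)) => (-1) ^ (k : ℕ)
  | .inr (.inl _), .inr (.inr (.inr (.inl _))) => (-1) ^ ((q - 1) / 4)
  | .inr (.inl _), .inr (.inr (.inr (.inr _))) => 0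
  -- degree `q - 1`
  | .inr (.inr (.inl _)), .inl _ => q - 1
  | .inr (.inr (.inl _)), .inr (.inl _) => -1
  | .inr (.inr (.inl _)), .inr (.inr (.inl _)) => 0
  | .inr (.inr (.inl _)), .inr (.inr (.inr (.inl _))) => 0
  | .inr (.inr (.inl c)), .inr (.inr (.inr (.inr k))) => -zetaSum (q + 1) (2 * k * c)
  -- degree `q`
  | .inr (.inr (.inr (.inl _))), .inl _ => q
  | .inr (.inr (.inr (.inl _))), .inr (.inl _) => 0
  | .inr (.inr (.inr (.inl _))), .inr (.inr (.inl _)) => 1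
  | .inr (.inr (.inr (.inl _))), .inr (.inr (.inr (.inl _))) => 1
  | .inr (.inr (.inr (.inl _))), .inr (.inr (.inr (.inr _))) => -1
  -- degree `q + 1`
  | .inr (.inr (.inr (.inr _))), .inl _ => q + 1
  | .inr (.inr (.inr (.inr _))), .inr (.inl _) => 1
  | .inr (.inr (.inr (.inr c))), .inr (.inr (.inl k)) => zetaSum (q - 1) (2 * k * c)
  | .inr (.inr (.inr (.inr c))), .inr (.inr (.inr (.inl _))) => 2 * (-1) ^ (c : ℕ)
  | .inr (.inr (.inr (.inr _))), .inr (.inr (.inr (.inr _))) => 0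

noncomputable def oneTable (q : ℕ) : FormalTable where
  Row := OneRow q
  Col := OneCol q
  entry := oneEntry q

/-- The generic character table of `PSL(2, q)`, interpolated to every integer `q ≥ 2`. -/
noncomputable def table (q : ℕ) : FormalTable :=
  if q % 2 = 0 then evenTable q else if q % 4 = 3 then threeTable q else oneTable q

/-- `R` is the interpolated fusion ring `R_q`: the fusion ring, with basis the rows of the
interpolated table, whose eigentable is that table. -/
def IsInterpolatedFusionRing (q : ℕ) (R : FusionRing (table q).Row) : Prop :=
  R.IsEigentable (table q).entry

end InterpolatedPSL2

/-!
The columns of the table carry class weights for which the mean of a product of three rows is given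
by an explicit natural number. As in Verlinde's formula, these numbers are the structure constants
of a fusion ring with the given eigentable, and conversely the eigentable determines the structure
constants.

A solution of the one spectrum system amounts to three products of two nontrivial irreducible
characters with a single common constituent `i₀`, joined cyclically by further multiplicity
conditions. A product of two nontrivial irreducible characters contains almost all irreducible
characters, unless both factors are halves of the same reducible series member. Hence `i₀` is
severely constrained or one of the pairs is exceptional. For large `q` both alternatives contradict
the abundance of common constituents; the cases `q ≤ 11` that escape this are
searched exhaustively.
-/

namespace FusionRing

variable {ι ι' κ : Type*} [Fintype ι] [DecidableEq ι] [Fintype ι'] [DecidableEq ι']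

theorem ext_of_N {R R' : FusionRing ι} (hN : R.N = R'.N) : R = R' := by
  have hone : R.one = R'.one := by
    have h := R.one_mul R'.one R.one
    rw [hN, R'.mul_one, if_pos rfl] at h
    exact of_not_not fun hne => one_ne_zero (h.trans (if_neg hne))
  have hdual : R.dual = R'.dual := by
    funext i
    have h := R.dual_right i (R.dual i)
    rw [hN, hone, R'.dual_right, if_pos rfl] at h
    exact of_not_not fun hne => zero_ne_one ((if_neg hne).symm.trans h)
  cases R
  cases R'
  simp only at hN hone hdual
  subst hN hone hdual
  rfl

theorem IsEigentable.mul_eq {R : FusionRing ι} {T : ι → κ → ℂ} (h : R.IsEigentable T)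
    (i j : ι) (s : κ) : T i s * T j s = ∑ k, (R.N i j k : ℂ) * T k s := by
  obtain ⟨-, v, hv⟩ := h
  have hmul : R.fusionMatrix i * R.fusionMatrix j = ∑ k, (R.N i j k : ℂ) • R.fusionMatrix k := by
    ext l n
    simp only [Matrix.mul_apply, fusionMatrix, Matrix.of_apply, Matrix.sum_apply,
      Matrix.smul_apply, smul_eq_mul, mul_comm (R.N i _ l : ℂ)]
    exact_mod_cast (R.assoc i j n l).symm
  have heig : (R.fusionMatrix i * R.fusionMatrix j).mulVec (v s) = (T i s * T j s) • v s := by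
    rw [← Matrix.mulVec_mulVec, hv, Matrix.mulVec_smul, hv, smul_smul, mul_comm]
  simp only [hmul, Matrix.sum_mulVec, Matrix.smul_mulVec, hv, smul_smul, ← Finset.sum_smul] at heig
  exact (smul_left_injective ℂ (v.ne_zero s) heig).symm

section Support

variable {R : FusionRing ι} {i k : ι}

theorem eq_of_one_mul_ne_zero (h : R.N R.one i k ≠ 0) : k = i :=
  of_not_not fun hne => h ((R.one_mul i k).trans (if_neg hne))

theorem eq_of_mul_one_ne_zero (h : R.N i R.one k ≠ 0) : k = i :=
  of_not_not fun hne => h ((R.mul_one i k).trans (if_neg hne))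

theorem eq_dual_of_ne_zero (h : R.N i k R.one ≠ 0) : k = R.dual i :=
  of_not_not fun hne => h ((R.dual_right i k).trans (if_neg hne))

end Support

theorem OneSpectrumSystem.ne_one {R : FusionRing ι} {i₀ i₁ i₂ i₃ i₄ i₅ i₆ i₇ i₈ i₉ : ι}
    (h : R.OneSpectrumSystem i₀ i₁ i₂ i₃ i₄ i₅ i₆ i₇ i₈ i₉) :
    i₄ ≠ R.one ∧ i₅ ≠ R.one ∧ i₆ ≠ R.one ∧ i₇ ≠ R.one ∧ i₈ ≠ R.one ∧ i₉ ≠ R.one := by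
  obtain ⟨⟨h1, h2, h3, h4, h5, h6⟩, -, -, h0, -⟩ := h
  refine ⟨?_, ?_, ?_, ?_, ?_, ?_⟩ <;> rintro rfl
  · rw [eq_of_one_mul_ne_zero h1, ← eq_of_mul_one_ne_zero h2] at h3
    exact h3 h0
  · rw [← eq_of_one_mul_ne_zero h2, ← eq_of_one_mul_ne_zero h3] at h1
    exact h1 h0
  · rw [R.frobenius_right, ← eq_of_mul_one_ne_zero h3, ← eq_dual_of_ne_zero h1] at h2
    exact h2 h0
  · rw [← eq_of_one_mul_ne_zero h4, eq_of_mul_one_ne_zero h5] at h6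
    exact h6 h0
  · rw [eq_dual_of_ne_zero h5, ← eq_of_one_mul_ne_zero h6, ← R.frobenius_left] at h4
    exact h4 h0
  · rw [← eq_of_mul_one_ne_zero h4, ← eq_of_mul_one_ne_zero h6] at h5
    exact h5 h0

theorem PassesOneSpectrumCriterion.of_equiv {R : FusionRing ι} {R' : FusionRing ι'} (e : ι' ≃ ι)
    (hN : ∀ i j k, R'.N i j k = R.N (e i) (e j) (e k)) (hdual : ∀ i, e (R'.dual i) = R.dual (e i))
    (h : R.PassesOneSpectrumCriterion) : R'.PassesOneSpectrumCriterion := by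
  intro i₀ i₁ i₂ i₃ i₄ i₅ i₆ i₇ i₈ i₉
  have hpair (a b c d : ι') : R'.pairSum a b c d = R.pairSum (e a) (e b) (e c) (e d) := by
    simp only [pairSum, hN]
    exact e.sum_comp fun k => R.N (e a) (e b) k * R.N (e c) (e d) k
  have htriple (a b c d x y : ι') : ∑ k, R'.N a b k * R'.N c d k * R'.N x y k
      = ∑ k, R.N (e a) (e b) k * R.N (e c) (e d) k * R.N (e x) (e y) k := by
    simp only [hN]
    exact e.sum_comp fun k => R.N (e a) (e b) k * R.N (e c) (e d) k * R.N (e x) (e y) k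
  unfold OneSpectrumSystem
  simp only [hpair, htriple]
  simp only [hN, hdual]
  exact h (e i₀) (e i₁) (e i₂) (e i₃) (e i₄) (e i₅) (e i₆) (e i₇) (e i₈) (e i₉)

/-- There is exactly one fusion ring with eigentable `T`, and it passes the one spectrum
criterion. -/
def IsPassingEigentable (T : ι → κ → ℂ) : Prop :=
  (∃! R : FusionRing ι, R.IsEigentable T) ∧
    ∀ R : FusionRing ι, R.IsEigentable T → R.PassesOneSpectrumCriterion

end FusionRing

/-- Verlinde data for a square table `T`: weights on the columns for which the total weight of the
product of the rows `i`, `j`, `k` is the natural number `M i j k`. Then `M i j k*` is the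
multiplicity of the row `k` in the product of the rows `i` and `j`. -/
structure VerlindeData {ι κ : Type*} [Fintype ι] [DecidableEq ι] [Fintype κ]
    (T : ι → κ → ℂ) (M : ι → ι → ι → ℕ) (one : ι) (dual : ι → ι) where
  weight : κ → ℂ
  card_eq : Fintype.card ι = Fintype.card κ
  row_one : ∀ s, T one s = 1
  sum_triple : ∀ i j k, ∑ s, weight s * (T i s * T j s * T k s) = M i j k
  pairing : ∀ i j, M i j one = if j = dual i then 1 else 0
  dual_triple : ∀ i j k, M (dual i) (dual j) (dual k) = M i j k

namespace VerlindeData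

variable {ι ι' κ κ' : Type*} [Fintype ι] [DecidableEq ι] [Fintype κ]
  [Fintype ι'] [DecidableEq ι']
  {T : ι → κ → ℂ} {M : ι → ι → ι → ℕ} {one : ι} {dual : ι → ι} (d : VerlindeData T M one dual)

include d

theorem comm (i j k : ι) : M i j k = M j i k := by
  have h := d.sum_triple i j k
  simp only [mul_comm (T i _) (T j _), d.sum_triple] at h
  exact_mod_cast h.symm

theorem right_comm (i j k : ι) : M i j k = M i k j := by
  have h := d.sum_triple i j k
  simp only [mul_right_comm (T i _) (T j _), d.sum_triple] at h
  exact_mod_cast h.symm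

theorem one_triple (i j : ι) : M one i j = if j = dual i then 1 else 0 := by
  rw [← d.pairing, d.comm, d.right_comm]

theorem dual_involutive : Function.Involutive dual := fun i => by
  have h := d.pairing (dual i) i
  rw [d.comm, d.pairing, if_pos rfl] at h
  exact of_not_not fun hne => one_ne_zero (h.trans (if_neg (Ne.symm hne)))

theorem dual_one : dual one = one := by
  have h := d.dual_triple (dual one) one one
  rw [d.comm (dual one), d.pairing, if_pos rfl, d.dual_involutive, d.one_triple,
    d.dual_involutive] at h
  exact of_not_not fun hne => zero_ne_one ((if_neg hne).symm.trans h)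

theorem sum_row_mul_dual (i j : ι) :
    ∑ s, d.weight s * (T i s * T (dual j) s) = if i = j then 1 else 0 := by
  have h := d.sum_triple i (dual j) one
  simp only [d.row_one, mul_one, d.pairing, d.dual_involutive.injective.eq_iff] at h
  rw [h]
  simp [eq_comm]

theorem sum_column_mul_dual [DecidableEq κ] (s t : κ) :
    ∑ j, d.weight s * T (dual j) s * T j t = if s = t then 1 else 0 := by
  let A : Matrix ι κ ℂ := Matrix.of fun i s => T i s
  let B : Matrix κ ι ℂ := Matrix.of fun s j => d.weight s * T (dual j) s
  have hAB : A * B = 1 := by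
    ext i j
    simp only [Matrix.mul_apply, Matrix.one_apply, ← d.sum_row_mul_dual, A, B, Matrix.of_apply,
      mul_left_comm]
  have hBA : B * A = 1 := (Matrix.mul_eq_one_comm_of_card_eq _ _ ℂ d.card_eq).1 hAB
  simpa only [Matrix.mul_apply, Matrix.one_apply, A, B, Matrix.of_apply]
    using congrFun (congrFun hBA s) t

theorem mul_eq (i j : ι) (t : κ) : T i t * T j t = ∑ k, (M i j (dual k) : ℂ) * T k t := by
  classical
  calc T i t * T j t
      = ∑ s, T i s * T j s * ∑ k, d.weight s * T (dual k) s * T k t := by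
        simp [d.sum_column_mul_dual]
    _ = ∑ k, (M i j (dual k) : ℂ) * T k t := by
        simp only [← d.sum_triple, Finset.sum_mul, Finset.mul_sum]
        rw [Finset.sum_comm]
        exact Finset.sum_congr rfl fun k _ => Finset.sum_congr rfl fun s _ => by ring

theorem eq_of_mul_eq {N : ι → ι → ι → ℕ}
    (h : ∀ i j s, T i s * T j s = ∑ k, (N i j k : ℂ) * T k s) (i j k : ι) :
    N i j k = M i j (dual k) := by
  have hM : (M i j (dual k) : ℂ) = N i j k :=
    calc (M i j (dual k) : ℂ)
        = ∑ l, (N i j l : ℂ) * ∑ s, d.weight s * (T l s * T (dual k) s) := by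
          simp only [← d.sum_triple, h i j, Finset.sum_mul, Finset.mul_sum]
          rw [Finset.sum_comm]
          exact Finset.sum_congr rfl fun l _ => Finset.sum_congr rfl fun s _ => by ring
      _ = N i j k := by simp [d.sum_row_mul_dual]
  exact_mod_cast hM.symm

theorem sum_mul_triple (i j k l : ι) :
    ((∑ m, M i j (dual m) * M m k (dual l) : ℕ) : ℂ)
      = ∑ s, d.weight s * (T i s * T j s * T k s * T (dual l) s) := by
  push_cast
  simp only [d.mul_eq i j, ← d.sum_triple _ k, Finset.mul_sum, Finset.sum_mul]
  rw [Finset.sum_comm]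
  exact Finset.sum_congr rfl fun s _ => Finset.sum_congr rfl fun m _ => by ring

/-- The fusion ring with structure constants `M i j k*`. -/
def toFusionRing : FusionRing ι where
  N i j k := M i j (dual k)
  one := one
  dual := dual
  assoc i j k l := by
    have h : ((∑ m, M i j (dual m) * M m k (dual l) : ℕ) : ℂ)
        = ((∑ m, M j k (dual m) * M m i (dual l) : ℕ) : ℂ) := by
      rw [d.sum_mul_triple i j k l, d.sum_mul_triple j k i l]
      exact Finset.sum_congr rfl fun s _ => by ring
    simpa only [d.comm i] using Nat.cast_injective h
  one_mul i k := by simp only [d.one_triple, d.dual_involutive.injective.eq_iff]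
  mul_one i k := by simp only [d.comm i, d.one_triple, d.dual_involutive.injective.eq_iff]
  dual_right i k := by rw [d.dual_one, d.pairing]
  dual_left i k := by rw [d.dual_one, d.comm, d.pairing]
  frobenius_left i j k := by rw [← d.dual_triple, d.dual_involutive, d.right_comm]
  frobenius_right i j k := by
    rw [← d.dual_triple i j, d.dual_involutive, d.right_comm, d.comm, d.right_comm]

theorem isEigentable : d.toFusionRing.IsEigentable T := by
  classical
  let v : κ → ι → ℂ := fun s j => T (dual j) s
  have hli : LinearIndependent ℂ v := by
    let f : κ → Module.Dual ℂ (ι → ℂ) := fun t => ∑ j, (d.weight t * T j t) • LinearMap.proj j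
    have hf (t s : κ) : f t (v s) = if t = s then 1 else 0 := by
      simp only [f, v, LinearMap.sum_apply, LinearMap.smul_apply, LinearMap.proj_apply,
        smul_eq_mul, ← d.sum_column_mul_dual]
      rw [← Equiv.sum_comp d.dual_involutive.toPerm]
      simp only [Function.Involutive.coe_toPerm, d.dual_involutive _]
    exact .of_pairwise_dual_eq_zero_one v f (fun t s h => (hf t s).trans (if_neg h))
      fun t => (hf t t).trans (if_pos rfl)
  have hspan : ⊤ ≤ Submodule.span ℂ (Set.range v) :=
    (hli.span_eq_top_of_card_eq_finrank' (by simp [d.card_eq])).ge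
  refine ⟨fun i j k => d.comm _ _ _, .mk hli hspan, fun i s => ?_⟩
  rw [Module.Basis.mk_apply]
  funext k
  simp only [Matrix.mulVec, dotProduct, FusionRing.fusionMatrix, Matrix.of_apply, Pi.smul_apply,
    smul_eq_mul, v, d.mul_eq i (dual k) s, toFusionRing]
  rw [← Equiv.sum_comp d.dual_involutive.toPerm]
  simp only [Function.Involutive.coe_toPerm, d.dual_involutive _, d.right_comm i]

theorem eq_toFusionRing {R : FusionRing ι} (h : R.IsEigentable T) : R = d.toFusionRing :=
  FusionRing.ext_of_N (funext₃ (d.eq_of_mul_eq h.mul_eq))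

/-- Verlinde data transported along bijections of the rows and of the columns. -/
def reindex [Fintype κ'] (e : ι' ≃ ι) (f : κ' ≃ κ) :
    VerlindeData (fun i s => T (e i) (f s)) (fun i j k => M (e i) (e j) (e k)) (e.symm one)
      (fun i => e.symm (dual (e i))) where
  weight s := d.weight (f s)
  card_eq := by rw [Fintype.card_congr e, d.card_eq, Fintype.card_congr f]
  row_one s := by simp only [e.apply_symm_apply, d.row_one]
  sum_triple i j k := by
    rw [← d.sum_triple]
    exact f.sum_comp fun s => d.weight s * (T (e i) s * T (e j) s * T (e k) s)
  pairing i j := by simp only [e.apply_symm_apply, d.pairing, e.eq_symm_apply]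
  dual_triple i j k := by simp only [e.apply_symm_apply, d.dual_triple]

theorem isPassingEigentable_of_bijective (h : d.toFusionRing.PassesOneSpectrumCriterion)
    {T' : ι' → κ' → ℂ} {e : ι' → ι} {f : κ' → κ} (he : Function.Bijective e)
    (hf : Function.Bijective f) (hT : ∀ i s, T' i s = T (e i) (f s)) :
    FusionRing.IsPassingEigentable T' := by
  let e' := Equiv.ofBijective e he
  let _ : Fintype κ' := .ofInjective f hf.injective
  let d' := d.reindex e' (Equiv.ofBijective f hf)
  obtain rfl : T' = fun i s => T (e i) (f s) := funext₂ hT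
  refine ⟨⟨d'.toFusionRing, d'.isEigentable, fun R hR => d'.eq_toFusionRing hR⟩, fun R hR => ?_⟩
  rw [d'.eq_toFusionRing hR]
  refine h.of_equiv e' (fun i j k => ?_) fun i => e'.apply_symm_apply _
  exact congrArg (M (e' i) (e' j)) (e'.apply_symm_apply _)

end VerlindeData

namespace InterpolatedPSL2

section RootsOfUnity

/-- The trace `ζ_n ^ t + ζ_n ^ (-t)` for an integer `t`; it extends `zetaSum` to negative
exponents. -/
noncomputable def zetaTrace (n : ℕ) (t : ℤ) : ℂ := zeta n ^ t + zeta n ^ (-t)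

theorem zetaSum_eq_zetaTrace (n m : ℕ) : zetaSum n m = zetaTrace n m := by
  simp [zetaSum, zetaTrace]

theorem zeta_ne_zero (n : ℕ) : zeta n ≠ 0 := Complex.exp_ne_zero _

theorem isPrimitiveRoot_zeta {n : ℕ} (hn : n ≠ 0) : IsPrimitiveRoot (zeta n) n :=
  Complex.isPrimitiveRoot_exp n hn

theorem zeta_two_mul_sq (n : ℕ) : zeta (2 * n) ^ 2 = zeta n := by
  rw [zeta, zeta, ← Complex.exp_nat_mul]
  congr 1
  push_cast
  rw [mul_div_assoc', mul_div_mul_left _ _ two_ne_zero]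

theorem zetaTrace_two_mul (n : ℕ) (t : ℤ) : zetaTrace (2 * n) (2 * t) = zetaTrace n t := by
  rw [zetaTrace, zetaTrace, ← zeta_two_mul_sq n]
  simp only [← mul_neg, zpow_mul]
  norm_cast

theorem zetaTrace_mul (n : ℕ) (a b : ℤ) :
    zetaTrace n a * zetaTrace n b = zetaTrace n (a + b) + zetaTrace n (a - b) := by
  have h := zeta_ne_zero n
  simp only [zetaTrace, neg_add, sub_eq_add_neg, zpow_add₀ h]
  ring_nf

theorem zetaTrace_neg (n : ℕ) (t : ℤ) : zetaTrace n (-t) = zetaTrace n t := by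
  rw [zetaTrace, zetaTrace, neg_neg, add_comm]

theorem zetaTrace_periodic {n : ℕ} (hn : n ≠ 0) (t x : ℤ) :
    zetaTrace n (n * x + t) = zetaTrace n t := by
  have h : zeta n ^ (n * x) = 1 := by
    rw [zpow_mul, zpow_natCast, (isPrimitiveRoot_zeta hn).pow_eq_one, one_zpow]
  simp only [zetaTrace, neg_add, zpow_add₀ (zeta_ne_zero n), zpow_neg _ (n * x : ℤ), h, one_mul,
    inv_one]

theorem zetaTrace_half {n m : ℕ} (hm : m ≠ 0) (h : n = 2 * m) (t : ℤ) :
    zetaTrace n (t * m) = 2 * (-1) ^ t := by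
  have hpow : zeta n ^ m = -1 :=
    ((isPrimitiveRoot_zeta (by lia)).pow (by lia) (h.trans (mul_comm _ _))).eq_neg_one_of_two_right
  simp only [zetaTrace, zpow_neg, mul_comm t, zpow_mul, zpow_natCast, hpow, ← inv_zpow, inv_neg,
    inv_one]
  ring

/-- `1` if `n` divides `x`, and `0` otherwise. -/
def dvdIndicator (n : ℕ) (x : ℤ) : ℕ := if (n : ℤ) ∣ x then 1 else 0

theorem sum_range_zeta_zpow {n : ℕ} (hn : n ≠ 0) (x : ℤ) :
    ∑ k ∈ Finset.range n, zeta n ^ (k * x) = n * dvdIndicator n x := by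
  have hpow : (zeta n ^ x) ^ n = 1 := by
    rw [← zpow_natCast, zpow_comm, zpow_natCast, (isPrimitiveRoot_zeta hn).pow_eq_one, one_zpow]
  simp only [mul_comm _ x, zpow_mul, zpow_natCast]
  by_cases h : (n : ℤ) ∣ x
  · simp [dvdIndicator, h, ((isPrimitiveRoot_zeta hn).zpow_eq_one_iff_dvd x).2 h]
  · have hne : zeta n ^ x ≠ 1 := mt ((isPrimitiveRoot_zeta hn).zpow_eq_one_iff_dvd x).1 h
    simp [dvdIndicator, h, geom_sum_eq hne, hpow]

theorem sum_Ioo_zetaTrace {n : ℕ} (hn : n ≠ 0) (x : ℤ) :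
    ∑ k ∈ Finset.Ioo 0 n, zetaTrace n (k * x) = 2 * n * dvdIndicator n x - 2 := by
  have hneg : dvdIndicator n (-x) = dvdIndicator n x := by simp [dvdIndicator]
  have hrange : ∑ k ∈ Finset.range n, zetaTrace n (k * x) = 2 * n * dvdIndicator n x := by
    simp only [zetaTrace, ← mul_neg, Finset.sum_add_distrib, sum_range_zeta_zpow hn, hneg]
    ring
  have hzero : zetaTrace n ((0 : ℕ) * x) = 2 := by
    simp [zetaTrace, one_add_one_eq_two]
  rw [← hrange, Finset.range_eq_Ico, ← Finset.Ioo_insert_left (Nat.pos_of_ne_zero hn),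
    Finset.sum_insert (by simp), hzero]
  ring

/-- The number of elements in the orbit of a nonzero element `k` of `ℤ/n` under `k ↦ -k`. -/
def negOrbitSize (n k : ℕ) : ℕ := if 2 * k = n then 1 else 2

theorem sum_Icc_half {n : ℕ} {f : ℕ → ℂ} (hf : ∀ k, 0 < k → k < n → f (n - k) = f k) :
    ∑ k ∈ Finset.Icc 1 (n / 2), negOrbitSize n k * f k = ∑ k ∈ Finset.Ioo 0 n, f k := by
  have hlow : (Finset.Ioo 0 n).filter (fun k => 2 * k ≤ n) = Finset.Icc 1 (n / 2) := by
    ext k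
    simp only [Finset.mem_filter, Finset.mem_Ioo, Finset.mem_Icc]
    lia
  have hhigh : ∑ k ∈ (Finset.Ioo 0 n).filter (fun k => ¬ 2 * k ≤ n), f k
      = ∑ k ∈ (Finset.Icc 1 (n / 2)).filter (fun k => 2 * k ≠ n), f k := by
    refine Finset.sum_nbij' (n - ·) (n - ·) ?_ ?_ ?_ ?_ ?_ <;>
      simp only [Finset.mem_filter, Finset.mem_Ioo, Finset.mem_Icc] <;>
      intro k hk
    iterate 4 lia
    exact (hf k (by lia) (by lia)).symm
  rw [← Finset.sum_filter_add_sum_filter_not (Finset.Ioo 0 n) (fun k => 2 * k ≤ n), hlow, hhigh,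
    Finset.sum_filter, ← Finset.sum_add_distrib]
  refine Finset.sum_congr rfl fun k _ => ?_
  by_cases h : 2 * k = n <;> simp [negOrbitSize, h, two_mul (f k)]

theorem sum_negOrbitSize_mul_zetaTrace {n : ℕ} (hn : n ≠ 0) (x : ℤ) :
    ∑ k ∈ Finset.Icc 1 (n / 2), (negOrbitSize n k : ℂ) * zetaTrace n (k * x)
      = 2 * n * dvdIndicator n x - 2 := by
  rw [← sum_Ioo_zetaTrace hn]
  refine sum_Icc_half fun k _ hk => ?_
  rw [Nat.cast_sub hk.le, ← zetaTrace_neg, ← zetaTrace_periodic hn _ x]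
  ring_nf

theorem sum_negOrbitSize {n : ℕ} (hn : n ≠ 0) :
    ∑ k ∈ Finset.Icc 1 (n / 2), (negOrbitSize n k : ℂ) = n - 1 := by
  have h := sum_Icc_half (n := n) (f := 1) fun _ _ _ => rfl
  simpa [Nat.cast_sub (Nat.one_le_iff_ne_zero.2 hn)] using h

end RootsOfUnity

section Parameters

/-- `gcd(2, q - 1)`, the order of the center of `SL(2, q)`. -/
def centerOrder (q : ℕ) : ℕ := Nat.gcd 2 (q - 1)

/-- The order `(q - ε) / gcd(2, q - 1)` of the split (`ε = 1`) and of the nonsplit (`ε = -1`) torus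
of `PSL(2, q)`. -/
def torusOrder (q : ℕ) (ε : ℤˣ) : ℕ := ((q - ε : ℤ) / centerOrder q).toNat

/-- For odd `q`, the sign `ε` with `q ≡ ε mod 4`; then `torusOrder q ε` is even. -/
def evenTorusSign (q : ℕ) : ℤˣ := if q % 4 = 1 then 1 else -1

/-- Half the order of the even torus. -/
def halfTorus (q : ℕ) : ℕ := torusOrder q (evenTorusSign q) / 2

variable {q : ℕ}

theorem centerOrder_of_even (hq : 2 ≤ q) (h : q % 2 = 0) : centerOrder q = 1 :=
  Nat.coprime_two_left.2 (Nat.odd_iff.2 (by lia))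

theorem centerOrder_of_odd (h : q % 2 = 1) : centerOrder q = 2 :=
  Nat.gcd_eq_left (by lia)

theorem centerOrder_ne_zero (q : ℕ) : centerOrder q ≠ 0 :=
  (Nat.gcd_pos_of_pos_left _ two_pos).ne'

theorem centerOrder_mul_torusOrder (hq : 2 ≤ q) (ε : ℤˣ) :
    (centerOrder q * torusOrder q ε : ℤ) = q - ε := by
  rcases Nat.mod_two_eq_zero_or_one q with h | h
  all_goals
    simp only [torusOrder, centerOrder_of_even hq, centerOrder_of_odd, h]
    obtain rfl | rfl := Int.units_eq_one_or ε <;> push_cast <;> lia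

theorem torusOrder_of_even (hq : 2 ≤ q) (h : q % 2 = 0) (ε : ℤˣ) :
    (torusOrder q ε : ℤ) = q - ε := by
  rw [← centerOrder_mul_torusOrder hq, centerOrder_of_even hq h, Nat.cast_one, one_mul]

theorem two_mul_torusOrder_of_odd (hq : 2 ≤ q) (h : q % 2 = 1) (ε : ℤˣ) :
    (2 * torusOrder q ε : ℤ) = q - ε := by
  rw [← centerOrder_mul_torusOrder hq, centerOrder_of_odd h, Nat.cast_ofNat]

theorem torusOrder_ne_zero (hq : 2 ≤ q) (ε : ℤˣ) : torusOrder q ε ≠ 0 := by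
  intro h
  have := centerOrder_mul_torusOrder hq ε
  rw [h, Nat.cast_zero, mul_zero] at this
  obtain rfl | rfl := Int.units_eq_one_or ε <;> push_cast at this <;> lia

theorem le_torusOrder (hq : 2 ≤ q) {n : ℕ} (hn : 2 * n + 1 ≤ q) (ε : ℤˣ) : n ≤ torusOrder q ε := by
  rcases Nat.mod_two_eq_zero_or_one q with h | h
  · have := torusOrder_of_even hq h ε
    obtain rfl | rfl := Int.units_eq_one_or ε <;> push_cast at this <;> lia
  · have := two_mul_torusOrder_of_odd hq h ε
    obtain rfl | rfl := Int.units_eq_one_or ε <;> push_cast at this <;> lia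

theorem two_mul_halfTorus (hq : 2 ≤ q) (h : q % 2 = 1) :
    2 * halfTorus q = torusOrder q (evenTorusSign q) := by
  have := two_mul_torusOrder_of_odd hq h (evenTorusSign q)
  unfold halfTorus
  generalize torusOrder q _ = n at *
  unfold evenTorusSign at this
  split_ifs at this <;> push_cast at this <;> lia

end Parameters

/-- The conjugacy classes of `PSL(2, q)`: the identity, the unipotent classes, and the classes of
the nontrivial elements of the tori up to inversion, written as powers of a generator. -/
inductive ClassLabel (q : ℕ) : Type
  | one
  | unipotent (k : Fin (centerOrder q))
  | torus (ε : ℤˣ) (k : Finset.Icc 1 (torusOrder q ε / 2))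

/-- The irreducible characters of `PSL(2, q)`: `st` is the Steinberg character, the series of sign
`1` and `-1` are the principal and the discrete series, and for odd `q` the two characters `half σ`
are the halves of the reducible member of one of the series. -/
inductive CharLabel (q : ℕ) : Type
  | triv
  | st
  | series (ε : ℤˣ) (x : Finset.Icc 1 ((torusOrder q ε - 1) / 2))
  | half (h : q % 2 = 1) (σ : ℤˣ)
  deriving DecidableEq

section ClassFunctions

variable {q : ℕ}

open ClassLabel

/-- The classes of each type, as a sum of index types; used to expand sums over all classes. -/
def ClassLabel.equivSum (q : ℕ) : ClassLabel q ≃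
    Unit ⊕ Fin (centerOrder q) ⊕ (ε : ℤˣ) × Finset.Icc 1 (torusOrder q ε / 2) where
  toFun
    | one => .inl ()
    | unipotent k => .inr (.inl k)
    | torus ε k => .inr (.inr ⟨ε, k⟩)
  invFun
    | .inl _ => one
    | .inr (.inl k) => unipotent k
    | .inr (.inr ⟨ε, k⟩) => torus ε k
  left_inv s := by cases s <;> rfl
  right_inv s := by rcases s with _ | _ | _ <;> rfl

instance : Fintype (ClassLabel q) := .ofEquiv _ (ClassLabel.equivSum q).symm

theorem sum_classLabel (f : ClassLabel q → ℂ) :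
    ∑ s, f s = f one + ∑ k, f (unipotent k) + ∑ ε, ∑ k, f (torus ε k) := by
  rw [← (ClassLabel.equivSum q).symm.sum_comp, Fintype.sum_sum_type, Fintype.sum_sum_type,
    Fintype.sum_sigma]
  simp [ClassLabel.equivSum, add_assoc]

/-- The size of a conjugacy class divided by the order `q (q ^ 2 - 1) / gcd(2, q - 1)` of the
group. -/
noncomputable def classWeight (q : ℕ) : ClassLabel q → ℂ
  | one => centerOrder q / (q * (q ^ 2 - 1))
  | unipotent _ => 1 / q
  | torus ε k => negOrbitSize (torusOrder q ε) k / (2 * torusOrder q ε)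

/-- The mean value of a class function. -/
noncomputable def mean (q : ℕ) : (ClassLabel q → ℂ) →ₗ[ℂ] ℂ :=
  ∑ s, classWeight q s • LinearMap.proj s

theorem mean_apply (f : ClassLabel q → ℂ) : mean q f = ∑ s, classWeight q s * f s := by
  simp [mean]

theorem mean_intCast_mul (z : ℤ) (f : ClassLabel q → ℂ) : mean q (z * f) = z * mean q f := by
  rw [← zsmul_eq_mul, map_zsmul, zsmul_eq_mul]

theorem mean_eq (f : ClassLabel q → ℂ) :
    mean q f = centerOrder q / (q * (q ^ 2 - 1)) * f one + 1 / q * ∑ k, f (unipotent k)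
      + ∑ ε, 1 / (2 * torusOrder q ε) * ∑ k : Finset.Icc 1 (torusOrder q ε / 2),
          negOrbitSize (torusOrder q ε) k * f (torus ε k) := by
  simp only [mean_apply, sum_classLabel, classWeight, Finset.mul_sum]
  refine congrArg _ (Finset.sum_congr rfl fun ε _ => Finset.sum_congr rfl fun k _ => ?_)
  ring

/-- The Gelfand–Graev character, induced from a nondegenerate character of a unipotent subgroup. -/
def gelfandGraev (q : ℕ) : ClassLabel q → ℂ
  | one => q ^ 2 - 1
  | unipotent _ => -1
  | torus _ _ => 0

/-- The Steinberg character. -/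
def steinberg (q : ℕ) : ClassLabel q → ℂ
  | one => q
  | unipotent _ => 0
  | torus ε _ => (ε : ℤ)

/-- The member with index `x` of the principal (`ε = 1`) or discrete (`ε = -1`) series. -/
noncomputable def seriesChar (q : ℕ) (ε : ℤˣ) (x : ℤ) : ClassLabel q → ℂ
  | one => q + (ε : ℤ)
  | unipotent _ => (ε : ℤ)
  | torus ε' k => if ε' = ε then (ε : ℤ) * zetaTrace (torusOrder q ε) (k * x) else 0

/-- A square root of `±q`, the quadratic Gauss sum when `q` is an odd prime. -/
noncomputable def gaussSum (q : ℕ) : ℂ :=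
  if q % 4 = 1 then (Real.sqrt q : ℂ) else Complex.I * (Real.sqrt q : ℂ)

/-- The difference `half 1 - half (-1)`. The `k`-th unipotent class of the tables is
`unipotent (k - 1)`, which accounts for the shifted sign. -/
noncomputable def halfDifference (q : ℕ) : ClassLabel q → ℂ
  | unipotent k => (-1) ^ ((k : ℕ) + 1) * gaussSum q
  | _ => 0

/-- The interpolated irreducible characters. -/
noncomputable def character (q : ℕ) : CharLabel q → ClassLabel q → ℂ
  | .triv => 1
  | .st => steinberg q
  | .series ε x => seriesChar q ε (x : ℕ)
  | .half _ σ => (1 / 2 : ℂ) •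
      (seriesChar q (evenTorusSign q) (halfTorus q) + (σ : ℤ) * halfDifference q)

theorem gaussSum_sq (q : ℕ) : gaussSum q ^ 2 = (evenTorusSign q : ℤ) * q := by
  have hsqrt : (Real.sqrt q : ℂ) ^ 2 = q := by
    exact_mod_cast congrArg ((↑) : ℝ → ℂ) (Real.sq_sqrt q.cast_nonneg)
  unfold gaussSum evenTorusSign
  split_ifs <;> simp [mul_pow, hsqrt]

theorem steinberg_eq_seriesChar_sub_one (q : ℕ) : steinberg q = seriesChar q 1 0 - 1 := by
  funext s
  rcases s with _ | k | ⟨ε, k⟩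
  · simp [steinberg, seriesChar]
  · simp [steinberg, seriesChar]
  · obtain rfl | rfl := Int.units_eq_one_or ε <;> simp [steinberg, seriesChar, zetaTrace]

theorem coe_units_mul_self (ε : ℤˣ) : ((ε : ℤ) : ℂ) * (ε : ℤ) = 1 := by
  obtain rfl | rfl := Int.units_eq_one_or ε <;> simp

theorem seriesChar_mul_seriesChar (ε : ℤˣ) (x y : ℤ) :
    seriesChar q ε x * seriesChar q ε y
      = gelfandGraev q + (ε : ℤ) * (seriesChar q ε (x + y) + seriesChar q ε (x - y)) := by
  funext s
  have hε := coe_units_mul_self ε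
  rcases s with _ | k | ⟨ε', k⟩ <;>
    simp only [Pi.mul_apply, Pi.add_apply, Pi.intCast_apply, seriesChar, gelfandGraev]
  · linear_combination -hε
  · linear_combination -hε
  · split_ifs
    · rw [mul_add (k : ℤ), mul_sub (k : ℤ)]
      linear_combination (ε : ℤ) * (ε : ℤ) * zetaTrace_mul (torusOrder q ε) (k * x) (k * y)
    · ring

theorem seriesChar_mul_seriesChar_of_ne {ε ε' : ℤˣ} (h : ε ≠ ε') (x y : ℤ) :
    seriesChar q ε x * seriesChar q ε' y = gelfandGraev q := by
  obtain rfl : ε' = -ε := by rwa [← Int.units_ne_iff_eq_neg, ne_comm]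
  funext s
  have hε := coe_units_mul_self ε
  rcases s with _ | k | ⟨ε', k⟩ <;>
    simp only [Pi.mul_apply, seriesChar, gelfandGraev, Units.val_neg, Int.cast_neg]
  · linear_combination -hε
  · linear_combination -hε
  · split_ifs with h1 h2
    · exact absurd (h1.symm.trans h2) h
    all_goals simp

theorem steinberg_mul_seriesChar (ε : ℤˣ) (x : ℤ) :
    steinberg q * seriesChar q ε x = gelfandGraev q + (ε : ℤ) * seriesChar q ε x := by
  funext s
  have hε := coe_units_mul_self ε
  rcases s with _ | k | ⟨ε', k⟩ <;>
    simp only [Pi.mul_apply, Pi.add_apply, Pi.intCast_apply, seriesChar, gelfandGraev, steinberg]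
  · linear_combination -hε
  · linear_combination -hε
  · split_ifs with h
    · subst h; ring
    · simp

theorem steinberg_mul_steinberg (q : ℕ) : steinberg q * steinberg q = gelfandGraev q + 1 := by
  funext s
  rcases s with _ | k | ⟨ε, k⟩ <;> simp [steinberg, gelfandGraev, pow_two, coe_units_mul_self]

theorem halfDifference_mul_self (k : Fin (centerOrder q)) :
    (halfDifference q * halfDifference q) (unipotent k) = (evenTorusSign q : ℤ) * q := by
  have hpow : ((-1 : ℂ) ^ ((k : ℕ) + 1)) ^ 2 = 1 := by rw [← pow_mul, mul_comm, pow_mul]; simp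
  rw [← gaussSum_sq, Pi.mul_apply, halfDifference]
  linear_combination gaussSum q ^ 2 * hpow

end ClassFunctions

section Means

variable {q : ℕ}

open ClassLabel

theorem cast_centerOrder_mul_torusOrder (hq : 2 ≤ q) (ε : ℤˣ) :
    (centerOrder q * torusOrder q ε : ℂ) = q - (ε : ℤ) := by
  exact_mod_cast congrArg ((↑) : ℤ → ℂ) (centerOrder_mul_torusOrder hq ε)

theorem cast_ne_zero (hq : 2 ≤ q) : (q : ℂ) ≠ 0 := by
  exact_mod_cast (by lia : q ≠ 0)

theorem cast_sub_unit_ne_zero (hq : 2 ≤ q) (ε : ℤˣ) : (q - (ε : ℤ) : ℂ) ≠ 0 := by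
  rw [← cast_centerOrder_mul_torusOrder hq]
  exact_mod_cast mul_ne_zero (centerOrder_ne_zero q) (torusOrder_ne_zero hq ε)

theorem cast_sq_sub_one_ne_zero (hq : 2 ≤ q) : (q ^ 2 - 1 : ℂ) ≠ 0 := by
  have h := mul_ne_zero (cast_sub_unit_ne_zero hq 1) (cast_sub_unit_ne_zero hq (-1))
  contrapose! h
  push_cast
  linear_combination h

theorem one_div_torusOrder (hq : 2 ≤ q) (ε : ℤˣ) :
    (1 / torusOrder q ε : ℂ) = centerOrder q / (q - (ε : ℤ)) := by
  rw [← cast_centerOrder_mul_torusOrder hq, div_mul_cancel_left₀, one_div]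
  exact_mod_cast centerOrder_ne_zero q

theorem mean_gelfandGraev_mul (hq : 2 ≤ q) {f : ClassLabel q → ℂ} {u : ℂ}
    (hu : ∀ k, f (unipotent k) = u) :
    mean q (gelfandGraev q * f) = centerOrder q * (f one - u) / q := by
  have h := cast_sq_sub_one_ne_zero hq
  have h' := cast_ne_zero hq
  simp only [mean_eq, Pi.mul_apply, gelfandGraev, hu, zero_mul, mul_zero, Finset.sum_const_zero,
    Finset.sum_const, Finset.card_univ, Fintype.card_fin, nsmul_eq_mul]
  field_simp
  ring

theorem mean_gelfandGraev_mul_seriesChar (hq : 2 ≤ q) (ε : ℤˣ) (x : ℤ) :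
    mean q (gelfandGraev q * seriesChar q ε x) = centerOrder q := by
  rw [mean_gelfandGraev_mul hq (u := (ε : ℤ)) fun k => rfl, seriesChar, add_sub_cancel_right,
    mul_div_cancel_right₀ _ (cast_ne_zero hq)]

theorem mean_gelfandGraev_mul_steinberg (hq : 2 ≤ q) :
    mean q (gelfandGraev q * steinberg q) = centerOrder q := by
  rw [mean_gelfandGraev_mul hq (u := 0) fun k => rfl, steinberg, sub_zero,
    mul_div_cancel_right₀ _ (cast_ne_zero hq)]

theorem mean_gelfandGraev (hq : 2 ≤ q) : mean q (gelfandGraev q) = 0 := by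
  simpa using mean_gelfandGraev_mul hq (f := 1) (u := 1) fun _ => rfl

theorem mean_one (hq : 2 ≤ q) : mean q 1 = 1 := by
  have htorus (ε : ℤˣ) : (1 / (2 * torusOrder q ε) : ℂ) * ∑ k : Finset.Icc 1 (torusOrder q ε / 2),
      (negOrbitSize (torusOrder q ε) k : ℂ) = 1 / 2 * (1 - centerOrder q / (q - (ε : ℤ))) := by
    have hn : (torusOrder q ε : ℂ) ≠ 0 := by exact_mod_cast torusOrder_ne_zero hq ε
    rw [Finset.sum_coe_sort (Finset.Icc 1 _) (fun k => (negOrbitSize _ k : ℂ)),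
      sum_negOrbitSize (torusOrder_ne_zero hq ε), ← one_div_torusOrder hq]
    field_simp
  have h := cast_ne_zero hq
  have hsq := cast_sq_sub_one_ne_zero hq
  have h1 := cast_sub_unit_ne_zero hq 1
  have h2 := cast_sub_unit_ne_zero hq (-1)
  simp only [mean_eq, Pi.one_apply, mul_one, htorus, Finset.sum_const, Finset.card_univ,
    Fintype.card_fin, nsmul_eq_mul, UnitsInt.univ]
  rw [Finset.sum_pair (by decide)]
  push_cast at h1 h2 ⊢
  field_simp
  ring

theorem mean_seriesChar (hq : 2 ≤ q) (ε : ℤˣ) (x : ℤ) :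
    mean q (seriesChar q ε x) = (ε : ℤ) * dvdIndicator (torusOrder q ε) x := by
  have htorus : (1 / (2 * torusOrder q ε) : ℂ) * ∑ k : Finset.Icc 1 (torusOrder q ε / 2),
      negOrbitSize (torusOrder q ε) k * ((ε : ℤ) * zetaTrace (torusOrder q ε) (k * x))
      = (ε : ℤ) * (dvdIndicator (torusOrder q ε) x - centerOrder q / (q - (ε : ℤ))) := by
    have hn : (torusOrder q ε : ℂ) ≠ 0 := by exact_mod_cast torusOrder_ne_zero hq ε
    simp only [mul_left_comm _ ((ε : ℤ) : ℂ), ← Finset.mul_sum]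
    rw [Finset.sum_coe_sort (Finset.Icc 1 _)
      (fun k => (negOrbitSize (torusOrder q ε) k : ℂ) * zetaTrace _ (k * x)),
      sum_negOrbitSize_mul_zetaTrace (torusOrder_ne_zero hq ε), ← one_div_torusOrder hq]
    field_simp
  have h := cast_ne_zero hq
  have h1 := cast_sub_unit_ne_zero hq ε
  have h2 := cast_sub_unit_ne_zero hq (-ε)
  rw [Units.val_neg, Int.cast_neg, sub_neg_eq_add] at h2
  have hε := coe_units_mul_self ε
  have hsq : (q ^ 2 - 1 : ℂ) = (q - (ε : ℤ)) * (q + (ε : ℤ)) := by linear_combination hε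
  have hone : (centerOrder q / (q * (q ^ 2 - 1)) * (q + (ε : ℤ)) : ℂ)
      = centerOrder q / (q * (q - (ε : ℤ))) := by
    rw [hsq]
    field_simp
  rw [mean_eq, Finset.sum_eq_single ε (fun ε' _ hne => by simp [seriesChar, hne])
    (absurd (Finset.mem_univ ε))]
  simp only [seriesChar, if_true, hone, htorus, Finset.sum_const, Finset.card_univ,
    Fintype.card_fin, nsmul_eq_mul]
  field_simp
  linear_combination -centerOrder q * hε

end Means

section TripleMeans

variable {q : ℕ}

open ClassLabel

theorem mean_steinberg (hq : 2 ≤ q) : mean q (steinberg q) = 0 := by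
  rw [steinberg_eq_seriesChar_sub_one, map_sub, mean_one hq, mean_seriesChar hq]
  simp [dvdIndicator]

theorem mean_steinberg_mul_steinberg (hq : 2 ≤ q) : mean q (steinberg q * steinberg q) = 1 := by
  rw [steinberg_mul_steinberg, map_add, mean_gelfandGraev hq, mean_one hq, zero_add]

theorem mean_steinberg_mul_seriesChar (hq : 2 ≤ q) (ε : ℤˣ) (x : ℤ) :
    mean q (steinberg q * seriesChar q ε x) = dvdIndicator (torusOrder q ε) x := by
  rw [steinberg_mul_seriesChar, map_add, mean_intCast_mul, mean_gelfandGraev hq,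
    mean_seriesChar hq, zero_add, ← mul_assoc, coe_units_mul_self, one_mul]

theorem mean_seriesChar_mul_seriesChar (hq : 2 ≤ q) (ε ε' : ℤˣ) (x y : ℤ) :
    mean q (seriesChar q ε x * seriesChar q ε' y) = if ε = ε' then
      (dvdIndicator (torusOrder q ε) (x + y) + dvdIndicator (torusOrder q ε) (x - y) : ℂ)
      else 0 := by
  split_ifs with h
  · subst h
    rw [seriesChar_mul_seriesChar, map_add, mean_intCast_mul, map_add, mean_gelfandGraev hq,
      mean_seriesChar hq, mean_seriesChar hq]
    linear_combination (dvdIndicator (torusOrder q ε) (x + y)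
      + dvdIndicator (torusOrder q ε) (x - y) : ℂ) * coe_units_mul_self ε
  · rw [seriesChar_mul_seriesChar_of_ne h, mean_gelfandGraev hq]

theorem mean_steinberg_triple (hq : 2 ≤ q) :
    mean q (steinberg q * steinberg q * steinberg q) = centerOrder q := by
  rw [steinberg_mul_steinberg, add_mul, one_mul, map_add, mean_gelfandGraev_mul_steinberg hq,
    mean_steinberg hq, add_zero]

theorem mean_steinberg_mul_steinberg_mul_seriesChar (hq : 2 ≤ q) (ε : ℤˣ) (x : ℤ) :
    mean q (steinberg q * steinberg q * seriesChar q ε x)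
      = centerOrder q + (ε : ℤ) * dvdIndicator (torusOrder q ε) x := by
  rw [steinberg_mul_steinberg, add_mul, one_mul, map_add, mean_gelfandGraev_mul_seriesChar hq,
    mean_seriesChar hq]

theorem mean_steinberg_mul_seriesChar_mul_seriesChar (hq : 2 ≤ q) (ε ε' : ℤˣ) (x y : ℤ) :
    mean q (steinberg q * seriesChar q ε x * seriesChar q ε' y)
      = centerOrder q + if ε = ε' then ((ε : ℤ) * (dvdIndicator (torusOrder q ε) (x + y)
          + dvdIndicator (torusOrder q ε) (x - y)) : ℂ) else 0 := by
  rw [steinberg_mul_seriesChar, add_mul, map_add, mean_gelfandGraev_mul_seriesChar hq, mul_assoc,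
    mean_intCast_mul, mean_seriesChar_mul_seriesChar hq, mul_ite, mul_zero]

/-- The number of `n ∣ x ± y ± z`. -/
def signCount (n : ℕ) (x y z : ℤ) : ℕ :=
  dvdIndicator n (x + y + z) + dvdIndicator n (x + y - z) + dvdIndicator n (x - y + z)
    + dvdIndicator n (x - y - z)

theorem mean_seriesChar_triple (hq : 2 ≤ q) (ε ε' ε'' : ℤˣ) (x y z : ℤ) :
    mean q (seriesChar q ε x * seriesChar q ε' y * seriesChar q ε'' z)
      = centerOrder q + if ε = ε' ∧ ε = ε'' then
        ((ε : ℤ) * signCount (torusOrder q ε) x y z : ℂ) else 0 := by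
  rcases eq_or_ne ε ε' with rfl | h
  · rw [seriesChar_mul_seriesChar, add_mul, map_add, mean_gelfandGraev_mul_seriesChar hq,
      mul_assoc, mean_intCast_mul, add_mul, map_add, mean_seriesChar_mul_seriesChar hq,
      mean_seriesChar_mul_seriesChar hq]
    simp only [true_and, signCount]
    split_ifs <;> push_cast <;> ring
  · rw [seriesChar_mul_seriesChar_of_ne h, mean_gelfandGraev_mul_seriesChar hq,
      if_neg fun h' => h h'.1, add_zero]

theorem mean_halfDifference_mul (h : q % 2 = 1) {f : ClassLabel q → ℂ} {u : ℂ}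
    (hu : ∀ k, f (unipotent k) = u) : mean q (halfDifference q * f) = 0 := by
  have hsum : ∑ k : Fin (centerOrder q), (-1 : ℂ) ^ ((k : ℕ) + 1) = 0 := by
    rw [centerOrder_of_odd h]
    simp
  simp [mean_eq, halfDifference, hu, ← Finset.sum_mul, hsum]

theorem mean_halfDifference_mul_self_mul (hq : 2 ≤ q) {f : ClassLabel q → ℂ} {u : ℂ}
    (hu : ∀ k, f (unipotent k) = u) :
    mean q (halfDifference q * halfDifference q * f)
      = centerOrder q * ((evenTorusSign q : ℤ) * u) := by
  have h := cast_ne_zero hq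
  have hsum (k : Fin (centerOrder q)) : (halfDifference q * halfDifference q * f) (unipotent k)
      = (evenTorusSign q : ℤ) * q * u := by
    rw [Pi.mul_apply, halfDifference_mul_self, hu]
  simp only [mean_eq, hsum]
  simp only [Pi.mul_apply, halfDifference, mul_zero, zero_mul, Finset.sum_const, Finset.card_univ,
    Fintype.card_fin, nsmul_eq_mul, zero_add, add_zero]
  field_simp

end TripleMeans

section Multiplicities

variable {q : ℕ}

open CharLabel

/-- The characters of each type, as a sum of index types; used to count them. -/
def CharLabel.equivSum (q : ℕ) :
    CharLabel q ≃ Unit ⊕ Unit ⊕ ((ε : ℤˣ) × Finset.Icc 1 ((torusOrder q ε - 1) / 2))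
      ⊕ {_σ : ℤˣ // q % 2 = 1} where
  toFun
    | triv => .inl ()
    | st => .inr (.inl ())
    | series ε x => .inr (.inr (.inl ⟨ε, x⟩))
    | half h σ => .inr (.inr (.inr ⟨σ, h⟩))
  invFun
    | .inl _ => triv
    | .inr (.inl _) => st
    | .inr (.inr (.inl ⟨ε, x⟩)) => series ε x
    | .inr (.inr (.inr ⟨σ, h⟩)) => half h σ
  left_inv a := by cases a <;> rfl
  right_inv a := by rcases a with _ | _ | _ | _ <;> rfl

instance : Fintype (CharLabel q) := .ofEquiv _ (CharLabel.equivSum q).symm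

/-- The complex conjugate character. -/
def CharLabel.dual : CharLabel q → CharLabel q
  | half h σ => half h (evenTorusSign q * σ)
  | a => a

/-- Some signed sum `x ± y ± z` is divisible by `n`, for `0 < x, y, z < n / 2`. -/
abbrev IsResonant (n x y z : ℕ) : Prop := x + y = z ∨ y + z = x ∨ z + x = y ∨ x + y + z = n

/-- `m + ε` if `p` holds, and `m` otherwise. -/
def addUnitIf (m : ℕ) (ε : ℤˣ) (p : Prop) [Decidable p] : ℕ :=
  if p then if ε = 1 then m + 1 else m - 1 else m

/-- The multiplicity of the trivial character in the product of three irreducible characters. -/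
def multiplicity : CharLabel q → CharLabel q → CharLabel q → ℕ
  | triv, a, b | a, triv, b | a, b, triv => if b = a.dual then 1 else 0
  | half _ σ, half _ τ, half _ υ => if σ = τ ∧ σ = υ then 1 else 0
  | st, half _ _, half _ _ | half _ _, st, half _ _ | half _ _, half _ _, st =>
      if evenTorusSign q = 1 then 1 else 0
  | series ε _, half _ σ, half _ τ | half _ σ, series ε _, half _ τ
  | half _ σ, half _ τ, series ε _ => if ε = evenTorusSign q * (σ * τ) then 1 else 0
  | series ε x, series ε' y, half _ _ | series ε x, half _ _, series ε' y
  | half _ _, series ε x, series ε' y =>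
      addUnitIf 1 ε (ε = ε' ∧ ε = evenTorusSign q ∧ (x + y : ℕ) = halfTorus q)
  | half _ _, _, _ | _, half _ _, _ | _, _, half _ _ => 1
  | series ε x, series ε' y, series ε'' z =>
      addUnitIf (centerOrder q) ε (ε = ε' ∧ ε = ε'' ∧ IsResonant (torusOrder q ε) x y z)
  | st, series ε x, series ε' y | series ε x, st, series ε' y | series ε x, series ε' y, st =>
      addUnitIf (centerOrder q) ε (ε = ε' ∧ (x : ℕ) = y)
  | _, _, _ => centerOrder q

theorem CharLabel.dual_dual (a : CharLabel q) : a.dual.dual = a := by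
  cases a <;> simp [dual, ← mul_assoc]

theorem CharLabel.eq_dual_comm {a b : CharLabel q} : a = b.dual ↔ b = a.dual :=
  ⟨by rintro rfl; exact b.dual_dual.symm, by rintro rfl; exact a.dual_dual.symm⟩

theorem cast_addUnitIf {m : ℕ} (hm : m ≠ 0) (ε : ℤˣ) (p : Prop) [Decidable p] :
    (addUnitIf m ε p : ℂ) = m + if p then ((ε : ℤ) : ℂ) else 0 := by
  unfold addUnitIf
  obtain rfl | rfl := Int.units_eq_one_or ε <;>
    split_ifs <;> simp_all [Nat.cast_sub (Nat.one_le_iff_ne_zero.2 hm), sub_eq_add_neg]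

theorem multiplicity_comm (a b c : CharLabel q) : multiplicity a b c = multiplicity b a c := by
  have hsign := Int.units_mul_self (evenTorusSign q)
  rcases a with _ | _ | ⟨ε, x⟩ | ⟨h, σ⟩ <;> rcases b with _ | _ | ⟨ε', y⟩ | ⟨h', τ⟩ <;>
    rcases c with _ | _ | ⟨ε'', z⟩ | ⟨h'', υ⟩ <;> simp only [multiplicity, addUnitIf, dual] <;>
      grind

theorem multiplicity_right_comm (a b c : CharLabel q) :
    multiplicity a b c = multiplicity a c b := by
  have hsign := Int.units_mul_self (evenTorusSign q)
  rcases a with _ | _ | ⟨ε, x⟩ | ⟨h, σ⟩ <;> rcases b with _ | _ | ⟨ε', y⟩ | ⟨h', τ⟩ <;>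
    rcases c with _ | _ | ⟨ε'', z⟩ | ⟨h'', υ⟩ <;> simp only [multiplicity, addUnitIf, dual] <;>
      grind

end Multiplicities

section MeanTriple

variable {q : ℕ}

open ClassLabel CharLabel

theorem dvdIndicator_of_lt {n : ℕ} {t : ℤ} (h : -n < t) (h' : t < 2 * n) :
    dvdIndicator n t = if t = 0 ∨ t = n then 1 else 0 := by
  refine if_congr ⟨fun hd => ?_, ?_⟩ rfl rfl
  · by_contra! hne
    rcases lt_or_gt_of_ne hne.1 with h0 | h0
    · exact absurd (Int.le_of_dvd (by lia) (dvd_neg.2 hd)) (by lia)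
    · have h1 := Int.le_of_dvd h0 hd
      exact absurd (Int.le_of_dvd (by lia) (dvd_sub_self_right.2 hd)) (by lia)
  · rintro (rfl | rfl)
    exacts [dvd_zero _, dvd_rfl]

theorem dvdIndicator_eq_zero {n : ℕ} {t : ℤ} (h : 0 < t) (h' : t < n) : dvdIndicator n t = 0 := by
  rw [dvdIndicator_of_lt (by lia) (by lia), if_neg (by lia)]

theorem signCount_eq {n x y z : ℕ} (hx : 0 < x) (hy : 0 < y) (hz : 0 < z)
    (hx' : 2 * x < n) (hy' : 2 * y < n) (hz' : 2 * z < n) :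
    signCount n x y z = if IsResonant n x y z then 1 else 0 := by
  simp (disch := lia) only [signCount, dvdIndicator_of_lt]
  split_ifs <;> lia

theorem signCount_half {n h x y : ℕ} (hn : 2 * h = n) (hx : 0 < x) (hy : 0 < y)
    (hx' : x < h) (hy' : y < h) : signCount n h x y = if x + y = h then 2 else 0 := by
  simp (disch := lia) only [signCount, dvdIndicator_of_lt]
  split_ifs <;> lia

theorem signCount_half_half {n h x : ℕ} (hn : 2 * h = n) (hx : 0 < x) (hx' : x ≤ h) :
    signCount n h h x = 0 := by
  simp (disch := lia) only [signCount, dvdIndicator_of_lt]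
  split_ifs <;> lia

theorem mean_half_mul (h : q % 2 = 1) (σ : ℤˣ) {f : ClassLabel q → ℂ} {u : ℂ}
    (hu : ∀ k, f (unipotent k) = u) :
    mean q (character q (half h σ) * f)
      = 1 / 2 * mean q (seriesChar q (evenTorusSign q) (halfTorus q) * f) := by
  rw [character, smul_mul_assoc, map_smul, add_mul, map_add, mul_assoc, mean_intCast_mul,
    mean_halfDifference_mul h hu, mul_zero, add_zero, smul_eq_mul]

theorem mean_half_mul_half_mul (hq : 2 ≤ q) (h : q % 2 = 1) (σ τ : ℤˣ) {f : ClassLabel q → ℂ}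
    {u : ℂ} (hu : ∀ k, f (unipotent k) = u) :
    mean q (character q (half h σ) * character q (half h τ) * f)
      = 1 / 4 * mean q (seriesChar q (evenTorusSign q) (halfTorus q)
          * seriesChar q (evenTorusSign q) (halfTorus q) * f)
        + ((evenTorusSign q * σ * τ : ℤˣ) : ℤ) * u / 2 := by
  set E := seriesChar q (evenTorusSign q) (halfTorus q)
  set δ := halfDifference q
  have hexpand : character q (half h σ) * character q (half h τ) * f
      = (1 / 4 : ℂ) • (E * E * f + (σ : ℤ) * (δ * (E * f)) + (τ : ℤ) * (δ * (E * f))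
        + (σ : ℤ) * ((τ : ℤ) * (δ * δ * f))) := by
    funext s
    simp only [character, Pi.mul_apply, Pi.add_apply, Pi.smul_apply, Pi.intCast_apply,
      smul_eq_mul, E, δ]
    ring
  have hE (k) : (E * f) (unipotent k) = (evenTorusSign q : ℤ) * u := by
    rw [Pi.mul_apply, hu]
    rfl
  rw [hexpand, map_smul, map_add, map_add, map_add]
  simp only [mean_intCast_mul, smul_eq_mul, δ, mean_halfDifference_mul h hE,
    mean_halfDifference_mul_self_mul hq hu, centerOrder_of_odd h]
  push_cast
  ring

theorem mean_half_triple (hq : 2 ≤ q) (h : q % 2 = 1) (σ τ υ : ℤˣ) :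
    mean q (character q (half h σ) * character q (half h τ) * character q (half h υ))
      = if σ = τ ∧ σ = υ then 1 else 0 := by
  set E := seriesChar q (evenTorusSign q) (halfTorus q)
  set δ := halfDifference q
  have hexpand : character q (half h σ) * character q (half h τ) * character q (half h υ)
      = (1 / 8 : ℂ) • (E * E * E + (σ + τ + υ : ℤ) * (δ * (E * E))
        + (σ * τ + σ * υ + τ * υ : ℤ) * (δ * δ * E) + (σ * τ * υ : ℤ) * (δ * (δ * δ))) := by
    funext s
    simp only [character, Pi.mul_apply, Pi.add_apply, Pi.smul_apply, Pi.intCast_apply,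
      smul_eq_mul, E, δ]
    push_cast
    ring
  have hn := two_mul_halfTorus hq h
  have hpos := torusOrder_ne_zero hq (evenTorusSign q)
  have hEEE : mean q (E * E * E) = 2 := by
    rw [mean_seriesChar_triple hq, signCount_half_half hn (by lia) le_rfl, centerOrder_of_odd h]
    simp
  have hδδE : mean q (δ * δ * E) = 2 := by
    rw [mean_halfDifference_mul_self_mul hq (u := (evenTorusSign q : ℤ)) fun _ => rfl,
      coe_units_mul_self, centerOrder_of_odd h]
    simp
  have hδEE : mean q (δ * (E * E)) = 0 :=
    mean_halfDifference_mul h (u := (evenTorusSign q : ℤ) * (evenTorusSign q : ℤ)) fun _ => rfl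
  have hδδδ : mean q (δ * (δ * δ)) = 0 := mean_halfDifference_mul h halfDifference_mul_self
  rw [hexpand, map_smul, map_add, map_add, map_add]
  simp only [mean_intCast_mul, hEEE, hδδE, hδEE, hδδδ]
  obtain rfl | rfl := Int.units_eq_one_or σ <;> obtain rfl | rfl := Int.units_eq_one_or τ <;>
    obtain rfl | rfl := Int.units_eq_one_or υ <;> norm_num

theorem coe_series_bounds {ε : ℤˣ} (x : Finset.Icc 1 ((torusOrder q ε - 1) / 2)) :
    0 < (x : ℕ) ∧ 2 * (x : ℕ) < torusOrder q ε := by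
  have h := Finset.mem_Icc.1 x.2
  lia

theorem halfTorus_pos (hq : 2 ≤ q) (h : q % 2 = 1) : 0 < halfTorus q := by
  have hn := two_mul_halfTorus hq h
  have hpos := torusOrder_ne_zero hq (evenTorusSign q)
  lia

theorem mean_character (hq : 2 ≤ q) (a : CharLabel q) :
    mean q (character q a) = if a = triv then 1 else 0 := by
  rcases a with _ | _ | ⟨ε, x⟩ | ⟨h, σ⟩
  · exact mean_one hq
  · exact mean_steinberg hq
  · obtain ⟨h, h'⟩ := coe_series_bounds x
    have hx : (x : ℕ) < torusOrder q ε := by lia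
    simp [character, mean_seriesChar hq, dvdIndicator_eq_zero, h, hx]
  · have hn := two_mul_halfTorus hq h
    have hpos := halfTorus_pos hq h
    have := mean_half_mul h σ (f := 1) (u := 1) fun _ => rfl
    rw [mul_one, mul_one, mean_seriesChar hq, dvdIndicator_eq_zero (by lia) (by lia)] at this
    simp [this]

theorem one_add_unit_div_two (ε : ℤˣ) : (1 + (ε : ℤ) : ℂ) / 2 = if ε = 1 then 1 else 0 := by
  obtain rfl | rfl := Int.units_eq_one_or ε <;> norm_num

theorem mean_half_mul_half (hq : 2 ≤ q) (h : q % 2 = 1) (σ τ : ℤˣ) :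
    mean q (character q (half h σ) * character q (half h τ))
      = if half h τ = (half h σ).dual then 1 else 0 := by
  have hn := two_mul_halfTorus hq h
  have hpos := halfTorus_pos hq h
  have hmean := mean_half_mul_half_mul hq h σ τ (f := 1) (u := 1) fun _ => rfl
  have hsum : dvdIndicator (torusOrder q (evenTorusSign q)) (halfTorus q + halfTorus q) = 1 := by
    rw [dvdIndicator_of_lt (by lia) (by lia), if_pos (by lia)]
  have hdiff : dvdIndicator (torusOrder q (evenTorusSign q)) (halfTorus q - halfTorus q) = 1 := by
    rw [sub_self, dvdIndicator, if_pos (dvd_zero _)]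
  rw [mul_one, mul_one, mean_seriesChar_mul_seriesChar hq, if_pos rfl, hsum, hdiff] at hmean
  rw [hmean]
  calc _ = (1 + ((evenTorusSign q * σ * τ : ℤˣ) : ℤ) : ℂ) / 2 := by ring
    _ = _ := by
      rw [one_add_unit_div_two]
      simp only [dual, half.injEq, mul_eq_one_iff_eq_inv, Int.units_inv_eq_self]
      exact if_congr eq_comm rfl rfl

theorem mean_series_mul_series (hq : 2 ≤ q) {ε ε' : ℤˣ}
    (x : Finset.Icc 1 ((torusOrder q ε - 1) / 2)) (y : Finset.Icc 1 ((torusOrder q ε' - 1) / 2)) :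
    mean q (character q (series ε x) * character q (series ε' y))
      = if ε = ε' ∧ (x : ℕ) = y then 1 else 0 := by
  obtain ⟨hx, hx'⟩ := coe_series_bounds x
  obtain ⟨hy, hy'⟩ := coe_series_bounds y
  rw [character, character, mean_seriesChar_mul_seriesChar hq]
  rcases eq_or_ne ε ε' with rfl | h
  · rw [if_pos rfl, dvdIndicator_eq_zero (by lia) (by lia), dvdIndicator_of_lt (by lia) (by lia)]
    have : ((x : ℤ) - y = 0 ∨ (x : ℤ) - y = torusOrder q ε) ↔ (x : ℕ) = y := by lia
    simp [this]
  · simp [h]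

theorem CharLabel.series_eq_series_iff {ε ε' : ℤˣ} {x : Finset.Icc 1 ((torusOrder q ε - 1) / 2)}
    {y : Finset.Icc 1 ((torusOrder q ε' - 1) / 2)} :
    series ε x = series ε' y ↔ ε = ε' ∧ (x : ℕ) = y := by
  rw [series.injEq]
  refine and_congr_right ?_
  rintro rfl
  rw [heq_eq_eq, Subtype.ext_iff]

theorem mean_half_mul_series (hq : 2 ≤ q) (h : q % 2 = 1) (σ ε : ℤˣ)
    (x : Finset.Icc 1 ((torusOrder q ε - 1) / 2)) :
    mean q (character q (half h σ) * character q (series ε x)) = 0 := by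
  obtain ⟨hx, hx'⟩ := coe_series_bounds x
  have hn := two_mul_halfTorus hq h
  rw [mean_half_mul h σ (u := (ε : ℤ)) fun _ => rfl, character, mean_seriesChar_mul_seriesChar hq]
  split_ifs with hε
  · subst hε
    rw [dvdIndicator_eq_zero (by lia) (by lia), dvdIndicator_eq_zero (by lia) (by lia)]
    simp
  · simp

theorem mean_half_mul_st (hq : 2 ≤ q) (h : q % 2 = 1) (σ : ℤˣ) :
    mean q (character q (half h σ) * character q st) = 0 := by
  have hn := two_mul_halfTorus hq h
  have hpos := halfTorus_pos hq h
  rw [mean_half_mul h σ (u := 0) fun _ => rfl, character, mul_comm (seriesChar _ _ _),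
    mean_steinberg_mul_seriesChar hq, dvdIndicator_eq_zero (by lia) (by lia)]
  simp

theorem mean_st_mul_series (hq : 2 ≤ q) (ε : ℤˣ) (x : Finset.Icc 1 ((torusOrder q ε - 1) / 2)) :
    mean q (character q st * character q (series ε x)) = 0 := by
  obtain ⟨hx, hx'⟩ := coe_series_bounds x
  rw [character, character, mean_steinberg_mul_seriesChar hq,
    dvdIndicator_eq_zero (by lia) (by lia), Nat.cast_zero]

theorem mean_character_mul (hq : 2 ≤ q) (a b : CharLabel q) :
    mean q (character q a * character q b) = if b = a.dual then 1 else 0 := by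
  rcases eq_or_ne a triv with rfl | ha
  · rw [character, one_mul]; exact mean_character hq b
  rcases eq_or_ne b triv with rfl | hb
  · rw [character, mul_one, mean_character hq]
    exact if_congr (eq_dual_comm (b := triv)) rfl rfl
  rcases a with _ | _ | ⟨ε, x⟩ | ⟨h, σ⟩ <;> rcases b with _ | _ | ⟨ε', y⟩ | ⟨h', τ⟩
  all_goals first | contradiction | skip
  · exact mean_steinberg_mul_steinberg hq
  · exact mean_st_mul_series hq _ _
  · rw [mul_comm]; exact mean_half_mul_st hq _ _
  · rw [mul_comm]; exact mean_st_mul_series hq _ _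
  · rw [mean_series_mul_series hq]
    exact if_congr (series_eq_series_iff.symm.trans eq_comm) rfl rfl
  · rw [mul_comm]; exact mean_half_mul_series hq _ _ _ _
  · exact mean_half_mul_st hq _ _
  · exact mean_half_mul_series hq _ _ _ _
  · exact mean_half_mul_half hq _ _ _

end MeanTriple

section MeanCharacterTriple

variable {q : ℕ}

open ClassLabel CharLabel

theorem forall_triple_of_sorted {α : Type*} (r : α → ℕ) {P : α → α → α → Prop}
    (hcomm : ∀ a b c, P a b c → P b a c) (hright : ∀ a b c, P a b c → P a c b)
    (hsorted : ∀ a b c, r b ≤ r a → r c ≤ r b → P a b c) (a b c : α) : P a b c := by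
  rcases le_total (r b) (r a) with hab | hab <;> rcases le_total (r c) (r b) with hbc | hbc <;>
    rcases le_total (r c) (r a) with hac | hac
  · exact hsorted a b c hab hbc
  · exact hsorted a b c hab hbc
  · exact hright _ _ _ (hsorted a c b hac hbc)
  · exact hright _ _ _ (hcomm _ _ _ (hsorted c a b hac hab))
  · exact hcomm _ _ _ (hsorted b a c hab hac)
  · exact hcomm _ _ _ (hright _ _ _ (hsorted b c a hbc hac))
  · exact hcomm _ _ _ (hright _ _ _ (hright _ _ _ (hsorted b a c hab hac)))
  · exact hright _ _ _ (hcomm _ _ _ (hright _ _ _ (hsorted c b a hbc hab)))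

variable {ε ε' ε'' : ℤˣ} (x : Finset.Icc 1 ((torusOrder q ε - 1) / 2))
  (y : Finset.Icc 1 ((torusOrder q ε' - 1) / 2)) (z : Finset.Icc 1 ((torusOrder q ε'' - 1) / 2))

theorem mean_half_mul_half_mul_st (hq : 2 ≤ q) (h : q % 2 = 1) (σ τ : ℤˣ) :
    mean q (character q (half h σ) * character q (half h τ) * character q st)
      = multiplicity (half h σ) (half h τ) st := by
  have hn := two_mul_halfTorus hq h
  have hpos := halfTorus_pos hq h
  rw [mean_half_mul_half_mul hq h σ τ (u := 0) fun _ => rfl, character,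
    mul_comm (_ * _) (steinberg q), ← mul_assoc, mean_steinberg_mul_seriesChar_mul_seriesChar hq,
    if_pos rfl, dvdIndicator_of_lt (by lia) (by lia), if_pos (by lia), sub_self, dvdIndicator,
    if_pos (dvd_zero _), centerOrder_of_odd h]
  have := one_add_unit_div_two (evenTorusSign q)
  simp only [multiplicity, Nat.cast_ite, Nat.cast_one, Nat.cast_zero, ← this]
  push_cast
  ring

theorem mean_half_mul_half_mul_series (hq : 2 ≤ q) (h : q % 2 = 1) (σ τ : ℤˣ) :
    mean q (character q (half h σ) * character q (half h τ) * character q (series ε x))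
      = multiplicity (half h σ) (half h τ) (series ε x) := by
  have hn := two_mul_halfTorus hq h
  obtain ⟨hx, hx'⟩ := coe_series_bounds x
  have htriple : mean q (seriesChar q (evenTorusSign q) (halfTorus q)
      * seriesChar q (evenTorusSign q) (halfTorus q) * seriesChar q ε (x : ℕ)) = 2 := by
    rw [mean_seriesChar_triple hq, centerOrder_of_odd h]
    split_ifs with hε
    · obtain ⟨-, rfl⟩ := hε
      rw [signCount_half_half hn hx (by lia)]
      simp
    · simp
  rw [mean_half_mul_half_mul hq h σ τ (u := (ε : ℤ)) fun _ => rfl, character, htriple]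
  calc _ = (1 + ((evenTorusSign q * σ * τ * ε : ℤˣ) : ℤ) : ℂ) / 2 := by push_cast; ring
    _ = _ := by
      rw [one_add_unit_div_two]
      simp only [multiplicity, Nat.cast_ite, Nat.cast_one, Nat.cast_zero]
      exact if_congr (by rw [mul_eq_one_iff_eq_inv, Int.units_inv_eq_self, mul_assoc, eq_comm])
        rfl rfl

theorem mean_half_mul_series_mul_series (hq : 2 ≤ q) (h : q % 2 = 1) (σ : ℤˣ) :
    mean q (character q (half h σ) * character q (series ε x) * character q (series ε' y))
      = multiplicity (half h σ) (series ε x) (series ε' y) := by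
  have hn := two_mul_halfTorus hq h
  obtain ⟨hx, hx'⟩ := coe_series_bounds x
  obtain ⟨hy, hy'⟩ := coe_series_bounds y
  rw [mul_assoc, mean_half_mul h σ (u := (ε : ℤ) * (ε' : ℤ)) fun _ => rfl, ← mul_assoc, character,
    character, mean_seriesChar_triple hq, multiplicity, cast_addUnitIf one_ne_zero,
    centerOrder_of_odd h]
  by_cases hε : evenTorusSign q = ε ∧ evenTorusSign q = ε'
  · obtain ⟨rfl, rfl⟩ := hε
    rw [signCount_half hn hx hy (by lia) (by lia)]
    simp only [and_self, if_true, true_and]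
    split_ifs <;> push_cast <;> ring
  · rw [if_neg hε, if_neg fun h => hε ⟨h.2.1.symm, h.2.1.symm.trans h.1⟩]
    norm_num

theorem mean_half_mul_series_mul_st (hq : 2 ≤ q) (h : q % 2 = 1) (σ : ℤˣ) :
    mean q (character q (half h σ) * character q (series ε x) * character q st)
      = multiplicity (half h σ) (series ε x) st := by
  have hn := two_mul_halfTorus hq h
  obtain ⟨hx, hx'⟩ := coe_series_bounds x
  rw [mul_assoc, mean_half_mul h σ (u := (ε : ℤ) * 0) fun _ => rfl, ← mul_assoc,
    mul_comm _ (character q st), ← mul_assoc, character, character,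
    mean_steinberg_mul_seriesChar_mul_seriesChar hq, centerOrder_of_odd h]
  rw [ite_eq_right_iff.2]
  · simp [multiplicity]
  · rintro rfl
    rw [dvdIndicator_eq_zero (by lia) (by lia), dvdIndicator_eq_zero (by lia) (by lia)]
    simp

theorem mean_half_mul_st_mul_st (hq : 2 ≤ q) (h : q % 2 = 1) (σ : ℤˣ) :
    mean q (character q (half h σ) * character q st * character q st)
      = multiplicity (half h σ) st st := by
  have hn := two_mul_halfTorus hq h
  have hpos := halfTorus_pos hq h
  rw [mul_assoc, mean_half_mul h σ (u := 0 * 0) fun _ => rfl, mul_comm (seriesChar _ _ _),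
    character, mean_steinberg_mul_steinberg_mul_seriesChar hq,
    dvdIndicator_eq_zero (by lia) (by lia), centerOrder_of_odd h]
  simp [multiplicity]

theorem mean_series_triple (hq : 2 ≤ q) :
    mean q (character q (series ε x) * character q (series ε' y) * character q (series ε'' z))
      = multiplicity (series ε x) (series ε' y) (series ε'' z) := by
  obtain ⟨hx, hx'⟩ := coe_series_bounds x
  obtain ⟨hy, hy'⟩ := coe_series_bounds y
  obtain ⟨hz, hz'⟩ := coe_series_bounds z
  rw [character, character, character, mean_seriesChar_triple hq, multiplicity,
    cast_addUnitIf (centerOrder_ne_zero q)]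
  by_cases hε : ε = ε' ∧ ε = ε''
  · obtain ⟨rfl, rfl⟩ := hε
    rw [signCount_eq hx hy hz hx' hy' hz']
    simp
  · rw [if_neg hε, if_neg fun h => hε ⟨h.1, h.2.1⟩]

theorem mean_series_mul_series_mul_st (hq : 2 ≤ q) :
    mean q (character q (series ε x) * character q (series ε' y) * character q st)
      = multiplicity (series ε x) (series ε' y) st := by
  obtain ⟨hx, hx'⟩ := coe_series_bounds x
  obtain ⟨hy, hy'⟩ := coe_series_bounds y
  rw [mul_comm, ← mul_assoc, character, character, character,
    mean_steinberg_mul_seriesChar_mul_seriesChar hq, multiplicity,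
    cast_addUnitIf (centerOrder_ne_zero q)]
  rcases eq_or_ne ε ε' with rfl | hε
  · rw [dvdIndicator_eq_zero (by lia) (by lia), dvdIndicator_of_lt (by lia) (by lia)]
    have hxy : ((x : ℤ) - y = 0 ∨ (x : ℤ) - y = torusOrder q ε) ↔ (x : ℕ) = y := by lia
    simp [hxy]
  · simp [hε]

theorem mean_series_mul_st_mul_st (hq : 2 ≤ q) :
    mean q (character q (series ε x) * character q st * character q st)
      = multiplicity (series ε x) st st := by
  obtain ⟨hx, hx'⟩ := coe_series_bounds x
  rw [mul_assoc, mul_comm, character, character, mean_steinberg_mul_steinberg_mul_seriesChar hq,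
    dvdIndicator_eq_zero (by lia) (by lia)]
  simp [multiplicity]

theorem mean_character_triple (hq : 2 ≤ q) (a b c : CharLabel q) :
    mean q (character q a * character q b * character q c) = multiplicity a b c := by
  refine forall_triple_of_sorted CharLabel.ctorIdx (P := fun a b c : CharLabel q =>
    mean q (character q a * character q b * character q c) = multiplicity a b c)
    (fun a b c h => ?_) (fun a b c h => ?_) (fun a b c hba hcb => ?_) a b c
  · rw [mul_comm (character q b), h, multiplicity_comm]
  · rw [mul_right_comm, h, multiplicity_right_comm]
  rcases c with _ | _ | ⟨ε'', z⟩ | ⟨h'', υ⟩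
  · rw [character, mul_one, mean_character_mul hq]
    rw [multiplicity_right_comm, multiplicity_comm, multiplicity, Nat.cast_ite, Nat.cast_one,
      Nat.cast_zero]
  all_goals rcases b with _ | _ | ⟨ε', y⟩ | ⟨h', τ⟩
  all_goals first | exact absurd hcb (of_decide_eq_false rfl) | skip
  all_goals rcases a with _ | _ | ⟨ε, x⟩ | ⟨h, σ⟩
  all_goals first | exact absurd hba (of_decide_eq_false rfl) | skip
  · exact mean_steinberg_triple hq
  · exact mean_series_mul_st_mul_st x hq
  · exact mean_half_mul_st_mul_st hq h σ
  · exact mean_series_mul_series_mul_st x y hq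
  · exact mean_half_mul_series_mul_st y hq h σ
  · exact mean_half_mul_half_mul_st hq h σ τ
  · exact mean_series_triple x y z hq
  · exact mean_half_mul_series_mul_series y z hq h σ
  · exact mean_half_mul_half_mul_series z hq h σ τ
  · rw [mean_half_triple hq]
    simp [multiplicity]

end MeanCharacterTriple

section CanonicalRing

variable {q : ℕ}

open CharLabel

theorem torusOrder_div_two_of_even (hq : 2 ≤ q) (h : q % 2 = 0) (ε : ℤˣ) :
    torusOrder q ε / 2 = (torusOrder q ε - 1) / 2 := by
  have := torusOrder_of_even hq h ε
  obtain rfl | rfl := Int.units_eq_one_or ε <;> push_cast at this <;> lia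

theorem sum_torusOrder_div_two_of_odd (hq : 2 ≤ q) (h : q % 2 = 1) :
    ∑ ε, torusOrder q ε / 2 = ∑ ε, (torusOrder q ε - 1) / 2 + 1 := by
  have h1 := two_mul_torusOrder_of_odd hq h 1
  have h2 := two_mul_torusOrder_of_odd hq h (-1)
  push_cast at h1 h2
  rw [UnitsInt.univ, Finset.sum_pair (by decide), Finset.sum_pair (by decide)]
  lia

theorem card_charLabel (hq : 2 ≤ q) :
    Fintype.card (CharLabel q) = Fintype.card (ClassLabel q) := by
  rw [Fintype.card_congr (CharLabel.equivSum q), Fintype.card_congr (ClassLabel.equivSum q)]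
  simp only [Fintype.card_sum, Fintype.card_sigma, Fintype.card_fin, Fintype.card_coe,
    Nat.card_Icc, Fintype.card_unit, Nat.add_sub_cancel]
  rcases Nat.mod_two_eq_zero_or_one q with h | h
  · rw [Fintype.card_subtype, centerOrder_of_even hq h, h]
    simp [torusOrder_div_two_of_even hq h]
  · rw [Fintype.card_subtype, centerOrder_of_odd h, h, sum_torusOrder_div_two_of_odd hq h]
    simp only [Finset.filter_true, Finset.card_univ, Fintype.card_units_int]
    lia

theorem multiplicity_triv (a b : CharLabel q) :
    multiplicity a b triv = if b = a.dual then 1 else 0 := by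
  rw [multiplicity_right_comm, multiplicity_comm, multiplicity]

theorem multiplicity_dual (a b c : CharLabel q) :
    multiplicity a.dual b.dual c.dual = multiplicity a b c := by
  have hsign := Int.units_mul_self (evenTorusSign q)
  rcases a with _ | _ | ⟨ε, x⟩ | ⟨h, σ⟩ <;> rcases b with _ | _ | ⟨ε', y⟩ | ⟨h', τ⟩ <;>
    rcases c with _ | _ | ⟨ε'', z⟩ | ⟨h'', υ⟩ <;> simp only [multiplicity, dual] <;>
      grind

/-- The Verlinde data of the interpolated character table. -/
noncomputable def verlindeData (hq : 2 ≤ q) :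
    VerlindeData (character q) multiplicity triv CharLabel.dual where
  weight := classWeight q
  card_eq := card_charLabel hq
  row_one _ := rfl
  sum_triple a b c := (mean_apply _).symm.trans (mean_character_triple hq a b c)
  pairing := multiplicity_triv
  dual_triple := multiplicity_dual

/-- The interpolated fusion ring, with basis indexed by the irreducible characters. -/
noncomputable def fusionRing (hq : 2 ≤ q) : FusionRing (CharLabel q) :=
  (verlindeData hq).toFusionRing

end CanonicalRing

section Tables

variable {q : ℕ}

open ClassLabel CharLabel

theorem mem_Icc_one_of_le {m n k : ℕ} (h : m ≤ n) (hk : k ∈ Finset.Icc 1 m) : k ∈ Finset.Icc 1 n :=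
  Finset.Icc_subset_Icc_right h hk

/-- The character of a row of the table for even `q`. -/
def evenRowLabel (hq : 2 ≤ q) (h : q % 2 = 0) : EvenRow q → CharLabel q
  | .inl _ => triv
  | .inr (.inl c) => series (-1) ⟨c, mem_Icc_one_of_le (by
      have := torusOrder_of_even hq h (-1); push_cast at this; lia) c.2⟩
  | .inr (.inr (.inl _)) => st
  | .inr (.inr (.inr c)) => series 1 ⟨c, mem_Icc_one_of_le (by
      have := torusOrder_of_even hq h 1; push_cast at this; lia) c.2⟩

/-- The conjugacy class of a column of the table for even `q`. -/
def evenColLabel (hq : 2 ≤ q) (h : q % 2 = 0) : EvenCol q → ClassLabel q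
  | .inl _ => one
  | .inr (.inl _) => unipotent ⟨0, by rw [centerOrder_of_even hq h]; exact one_pos⟩
  | .inr (.inr (.inl k)) => torus 1 ⟨k, mem_Icc_one_of_le (by
      have := torusOrder_of_even hq h 1; push_cast at this; lia) k.2⟩
  | .inr (.inr (.inr k)) => torus (-1) ⟨k, mem_Icc_one_of_le (by
      have := torusOrder_of_even hq h (-1); push_cast at this; lia) k.2⟩

theorem evenRowLabel_bijective (hq : 2 ≤ q) (h : q % 2 = 0) :
    Function.Bijective (evenRowLabel hq h) := by
  have h1 := torusOrder_of_even hq h 1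
  have h2 := torusOrder_of_even hq h (-1)
  push_cast at h1 h2
  constructor
  · rintro (_ | c | _ | c) (_ | c' | _ | c') <;> simp [evenRowLabel]
  · rintro (_ | _ | ⟨ε, x⟩ | ⟨h', σ⟩)
    · exact ⟨.inl (), rfl⟩
    · exact ⟨.inr (.inr (.inl ())), rfl⟩
    · obtain rfl | rfl := Int.units_eq_one_or ε
      · exact ⟨.inr (.inr (.inr ⟨x, mem_Icc_one_of_le (by lia) x.2⟩)), rfl⟩
      · exact ⟨.inr (.inl ⟨x, mem_Icc_one_of_le (by lia) x.2⟩), rfl⟩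
    · lia

theorem evenColLabel_bijective (hq : 2 ≤ q) (h : q % 2 = 0) :
    Function.Bijective (evenColLabel hq h) := by
  have h1 := torusOrder_of_even hq h 1
  have h2 := torusOrder_of_even hq h (-1)
  push_cast at h1 h2
  constructor
  · rintro (_ | _ | k | k) (_ | _ | k' | k') <;> simp [evenColLabel]
  · rintro (_ | k | ⟨ε, k⟩)
    · exact ⟨.inl (), rfl⟩
    · have hk := k.2
      simp only [centerOrder_of_even hq h] at hk
      exact ⟨.inr (.inl ()), congrArg unipotent (Fin.ext (by simp; lia))⟩
    · obtain rfl | rfl := Int.units_eq_one_or ε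
      · exact ⟨.inr (.inr (.inl ⟨k, mem_Icc_one_of_le (by lia) k.2⟩)), rfl⟩
      · exact ⟨.inr (.inr (.inr ⟨k, mem_Icc_one_of_le (by lia) k.2⟩)), rfl⟩

theorem evenEntry_eq (hq : 2 ≤ q) (h : q % 2 = 0) (i : EvenRow q) (s : EvenCol q) :
    evenEntry q i s = character q (evenRowLabel hq h i) (evenColLabel hq h s) := by
  have h1 : torusOrder q 1 = q - 1 := by
    have := torusOrder_of_even hq h 1; push_cast at this; lia
  have h2 : torusOrder q (-1) = q + 1 := by
    have := torusOrder_of_even hq h (-1); push_cast at this; lia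
  rcases i with _ | c | _ | c <;> rcases s with _ | _ | k | k <;>
    simp [evenEntry, evenRowLabel, evenColLabel, character, steinberg, seriesChar,
      zetaSum_eq_zetaTrace, h1, h2, sub_eq_add_neg, show (1 : ℤˣ) ≠ -1 by decide,
      show (-1 : ℤˣ) ≠ 1 by decide]

theorem zetaSum_eq_zetaTrace_half {n m : ℕ} (h : 2 * m = n) (k c : ℕ) :
    zetaSum n (2 * k * c) = zetaTrace m (k * c) := by
  rw [zetaSum_eq_zetaTrace, ← h, mul_assoc, Nat.cast_mul, Nat.cast_ofNat, zetaTrace_two_mul,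
    Nat.cast_mul]

/-- The character of a row of the table for `q ≡ 3 mod 4`. -/
def threeRowLabel (hq : 2 ≤ q) (h : q % 4 = 3) : ThreeRow q → CharLabel q
  | .inl _ => triv
  | .inr (.inl c) => half (by lia) ((-1) ^ (c : ℕ))
  | .inr (.inr (.inl c)) => series (-1) ⟨c, mem_Icc_one_of_le (by
      have := two_mul_torusOrder_of_odd hq (by lia) (-1); push_cast at this; lia) c.2⟩
  | .inr (.inr (.inr (.inl _))) => st
  | .inr (.inr (.inr (.inr c))) => series 1 ⟨c, mem_Icc_one_of_le (by
      have := two_mul_torusOrder_of_odd hq (by lia) 1; push_cast at this; lia) c.2⟩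

/-- The conjugacy class of a column of the table for `q ≡ 3 mod 4`. -/
def threeColLabel (hq : 2 ≤ q) (h : q % 4 = 3) : ThreeCol q → ClassLabel q
  | .inl _ => one
  | .inr (.inl k) => unipotent ⟨k - 1, by
      have := Finset.mem_Icc.1 k.2; rw [centerOrder_of_odd (by lia)]; lia⟩
  | .inr (.inr (.inl k)) => torus 1 ⟨k, mem_Icc_one_of_le (by
      have := two_mul_torusOrder_of_odd hq (by lia) 1; push_cast at this; lia) k.2⟩
  | .inr (.inr (.inr (.inl k))) => torus (-1) ⟨k, mem_Icc_one_of_le (by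
      have := two_mul_torusOrder_of_odd hq (by lia) (-1); push_cast at this; lia) k.2⟩
  | .inr (.inr (.inr (.inr _))) => torus (-1) ⟨(q + 1) / 4, Finset.mem_Icc.2 (by
      have := two_mul_torusOrder_of_odd hq (by lia) (-1); push_cast at this; lia)⟩

theorem neg_one_pow_inj {c c' : Finset.Icc 1 2} :
    (-1 : ℤˣ) ^ (c : ℕ) = (-1) ^ (c' : ℕ) ↔ c = c' := by
  revert c c'
  decide

theorem exists_neg_one_pow (σ : ℤˣ) : ∃ c : Finset.Icc 1 2, (-1) ^ (c : ℕ) = σ := by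
  revert σ
  decide

theorem threeRowLabel_bijective (hq : 2 ≤ q) (h : q % 4 = 3) :
    Function.Bijective (threeRowLabel hq h) := by
  have h1 := two_mul_torusOrder_of_odd hq (by lia) 1
  have h2 := two_mul_torusOrder_of_odd hq (by lia) (-1)
  push_cast at h1 h2
  constructor
  · rintro (_ | c | c | _ | c) (_ | c' | c' | _ | c') <;>
      simp +contextual [threeRowLabel, neg_one_pow_inj]
  · rintro (_ | _ | ⟨ε, x⟩ | ⟨h', σ⟩)
    · exact ⟨.inl (), rfl⟩
    · exact ⟨.inr (.inr (.inr (.inl ()))), rfl⟩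
    · obtain rfl | rfl := Int.units_eq_one_or ε
      · exact ⟨.inr (.inr (.inr (.inr ⟨x, mem_Icc_one_of_le (by lia) x.2⟩))), rfl⟩
      · exact ⟨.inr (.inr (.inl ⟨x, mem_Icc_one_of_le (by lia) x.2⟩)), rfl⟩
    · obtain ⟨c, rfl⟩ := exists_neg_one_pow σ
      exact ⟨.inr (.inl c), rfl⟩

theorem threeColLabel_bijective (hq : 2 ≤ q) (h : q % 4 = 3) :
    Function.Bijective (threeColLabel hq h) := by
  have h1 := two_mul_torusOrder_of_odd hq (by lia) 1
  have h2 := two_mul_torusOrder_of_odd hq (by lia) (-1)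
  push_cast at h1 h2
  constructor
  · rintro (_ | ⟨k, hk⟩ | k | ⟨k, hk⟩ | _) (_ | ⟨k', hk'⟩ | k' | ⟨k', hk'⟩ | _) <;>
      grind [threeColLabel]
  · rintro (_ | ⟨k, hk⟩ | ⟨ε, k, hk⟩)
    · exact ⟨.inl (), rfl⟩
    · rw [centerOrder_of_odd (by lia)] at hk
      exact ⟨.inr (.inl ⟨k + 1, Finset.mem_Icc.2 (by lia)⟩), rfl⟩
    · obtain ⟨hk0, hk'⟩ := Finset.mem_Icc.1 hk
      obtain rfl | rfl := Int.units_eq_one_or ε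
      · exact ⟨.inr (.inr (.inl ⟨k, Finset.mem_Icc.2 (by lia)⟩)), rfl⟩
      · rcases eq_or_ne k ((q + 1) / 4) with rfl | hne
        · exact ⟨.inr (.inr (.inr (.inr ()))), rfl⟩
        · exact ⟨.inr (.inr (.inr (.inl ⟨k, Finset.mem_Icc.2 (by lia)⟩))), rfl⟩

theorem character_half_one (h : q % 2 = 1) (σ : ℤˣ) :
    character q (half h σ) one = (q + (evenTorusSign q : ℤ)) / 2 := by
  simp only [character, Pi.smul_apply, Pi.add_apply, seriesChar, Pi.mul_apply, Pi.intCast_apply,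
    halfDifference, smul_eq_mul]
  ring

theorem character_half_unipotent (h : q % 2 = 1) (σ : ℤˣ) (k : Fin (centerOrder q)) :
    character q (half h σ) (unipotent k)
      = ((evenTorusSign q : ℤ) + (-1) ^ ((k : ℕ) + 1) * (σ : ℤ) * gaussSum q) / 2 := by
  simp only [character, Pi.smul_apply, Pi.add_apply, seriesChar, Pi.mul_apply, Pi.intCast_apply,
    halfDifference, smul_eq_mul]
  ring

theorem character_half_torus (hq : 2 ≤ q) (h : q % 2 = 1) (σ ε : ℤˣ)
    (k : Finset.Icc 1 (torusOrder q ε / 2)) :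
    character q (half h σ) (torus ε k)
      = if ε = evenTorusSign q then (ε : ℤ) * (-1) ^ (k : ℕ) else 0 := by
  have htrace := zetaTrace_half (halfTorus_pos hq h).ne' (two_mul_halfTorus hq h).symm k
  split_ifs with hε
  · subst hε
    simp only [character, Pi.smul_apply, Pi.add_apply, seriesChar, if_true, htrace, Pi.mul_apply,
      Pi.intCast_apply, halfDifference, smul_eq_mul, zpow_natCast]
    push_cast
    ring
  · simp [character, seriesChar, halfDifference, hε]

theorem zetaTrace_halfTorus_mul (hq : 2 ≤ q) (h : q % 2 = 1) (c : ℕ) :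
    zetaTrace (torusOrder q (evenTorusSign q)) (halfTorus q * c) = 2 * (-1) ^ c := by
  rw [mul_comm]
  exact_mod_cast zetaTrace_half (halfTorus_pos hq h).ne' (two_mul_halfTorus hq h).symm c

theorem threeEntry_eq (hq : 2 ≤ q) (h : q % 4 = 3) (i : ThreeRow q) (s : ThreeCol q) :
    threeEntry q i s = character q (threeRowLabel hq h i) (threeColLabel hq h s) := by
  have h1 := two_mul_torusOrder_of_odd hq (by lia) 1
  have h2 := two_mul_torusOrder_of_odd hq (by lia) (-1)
  push_cast at h1 h2
  have hsign : evenTorusSign q = -1 := by rw [evenTorusSign, if_neg (by lia)]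
  have hhalf := two_mul_halfTorus hq (by lia)
  have hcenter := zetaTrace_halfTorus_mul hq (by lia)
  rw [hsign] at hhalf hcenter
  have hm : (q + 1) / 4 = halfTorus q := by lia
  have hsum1 := zetaSum_eq_zetaTrace_half (n := q - 1) (m := torusOrder q 1) (by lia)
  have hsum2 := zetaSum_eq_zetaTrace_half (n := q + 1) (m := torusOrder q (-1)) (by lia)
  have hk (k : Finset.Icc 1 2) : (k : ℕ) - 1 + 1 = (k : ℕ) :=
    Nat.sub_add_cancel (Finset.mem_Icc.1 k.2).1
  have hne : (1 : ℤˣ) ≠ -1 := by decide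
  rcases i with _ | c | c | _ | c <;> rcases s with _ | k | k | k | _ <;>
    simp only [threeEntry, threeRowLabel, threeColLabel, character_half_one,
      character_half_unipotent, character_half_torus hq]
  all_goals
    simp [character, steinberg, seriesChar, hsum1, hsum2, hcenter, hsign, hm, gaussSum, h, hk, hne,
      hne.symm, pow_add, sub_eq_add_neg]
  ring

/-- The character of a row of the table for `q ≡ 1 mod 4`. -/
def oneRowLabel (hq : 2 ≤ q) (h : q % 4 = 1) : OneRow q → CharLabel q
  | .inl _ => triv
  | .inr (.inl c) => half (by lia) ((-1) ^ (c : ℕ))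
  | .inr (.inr (.inl c)) => series (-1) ⟨c, mem_Icc_one_of_le (by
      have := two_mul_torusOrder_of_odd hq (by lia) (-1); push_cast at this; lia) c.2⟩
  | .inr (.inr (.inr (.inl _))) => st
  | .inr (.inr (.inr (.inr c))) => series 1 ⟨c, mem_Icc_one_of_le (by
      have := two_mul_torusOrder_of_odd hq (by lia) 1; push_cast at this; lia) c.2⟩

/-- The conjugacy class of a column of the table for `q ≡ 1 mod 4`. -/
def oneColLabel (hq : 2 ≤ q) (h : q % 4 = 1) : OneCol q → ClassLabel q
  | .inl _ => one
  | .inr (.inl k) => unipotent ⟨k - 1, by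
      have := Finset.mem_Icc.1 k.2; rw [centerOrder_of_odd (by lia)]; lia⟩
  | .inr (.inr (.inl k)) => torus 1 ⟨k, mem_Icc_one_of_le (by
      have := two_mul_torusOrder_of_odd hq (by lia) 1; push_cast at this; lia) k.2⟩
  | .inr (.inr (.inr (.inl _))) => torus 1 ⟨(q - 1) / 4, Finset.mem_Icc.2 (by
      have := two_mul_torusOrder_of_odd hq (by lia) 1; push_cast at this; lia)⟩
  | .inr (.inr (.inr (.inr k))) => torus (-1) ⟨k, mem_Icc_one_of_le (by
      have := two_mul_torusOrder_of_odd hq (by lia) (-1); push_cast at this; lia) k.2⟩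

theorem oneRowLabel_bijective (hq : 2 ≤ q) (h : q % 4 = 1) :
    Function.Bijective (oneRowLabel hq h) := by
  have h1 := two_mul_torusOrder_of_odd hq (by lia) 1
  have h2 := two_mul_torusOrder_of_odd hq (by lia) (-1)
  push_cast at h1 h2
  constructor
  · rintro (_ | c | c | _ | c) (_ | c' | c' | _ | c') <;>
      simp +contextual [oneRowLabel, neg_one_pow_inj]
  · rintro (_ | _ | ⟨ε, x⟩ | ⟨h', σ⟩)
    · exact ⟨.inl (), rfl⟩
    · exact ⟨.inr (.inr (.inr (.inl ()))), rfl⟩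
    · obtain rfl | rfl := Int.units_eq_one_or ε
      · exact ⟨.inr (.inr (.inr (.inr ⟨x, mem_Icc_one_of_le (by lia) x.2⟩))), rfl⟩
      · exact ⟨.inr (.inr (.inl ⟨x, mem_Icc_one_of_le (by lia) x.2⟩)), rfl⟩
    · obtain ⟨c, rfl⟩ := exists_neg_one_pow σ
      exact ⟨.inr (.inl c), rfl⟩

theorem oneColLabel_bijective (hq : 2 ≤ q) (h : q % 4 = 1) :
    Function.Bijective (oneColLabel hq h) := by
  have h1 := two_mul_torusOrder_of_odd hq (by lia) 1
  have h2 := two_mul_torusOrder_of_odd hq (by lia) (-1)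
  push_cast at h1 h2
  constructor
  · rintro (_ | ⟨k, hk⟩ | ⟨k, hk⟩ | _ | k) (_ | ⟨k', hk'⟩ | ⟨k', hk'⟩ | _ | k') <;>
      grind [oneColLabel]
  · rintro (_ | ⟨k, hk⟩ | ⟨ε, k, hk⟩)
    · exact ⟨.inl (), rfl⟩
    · rw [centerOrder_of_odd (by lia)] at hk
      exact ⟨.inr (.inl ⟨k + 1, Finset.mem_Icc.2 (by lia)⟩), rfl⟩
    · obtain ⟨hk0, hk'⟩ := Finset.mem_Icc.1 hk
      obtain rfl | rfl := Int.units_eq_one_or ε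
      · rcases eq_or_ne k ((q - 1) / 4) with rfl | hne
        · exact ⟨.inr (.inr (.inr (.inl ()))), rfl⟩
        · exact ⟨.inr (.inr (.inl ⟨k, Finset.mem_Icc.2 (by lia)⟩)), rfl⟩
      · exact ⟨.inr (.inr (.inr (.inr ⟨k, Finset.mem_Icc.2 (by lia)⟩))), rfl⟩

theorem oneEntry_eq (hq : 2 ≤ q) (h : q % 4 = 1) (i : OneRow q) (s : OneCol q) :
    oneEntry q i s = character q (oneRowLabel hq h i) (oneColLabel hq h s) := by
  have h1 := two_mul_torusOrder_of_odd hq (by lia) 1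
  have h2 := two_mul_torusOrder_of_odd hq (by lia) (-1)
  push_cast at h1 h2
  have hsign : evenTorusSign q = 1 := by rw [evenTorusSign, if_pos h]
  have hhalf := two_mul_halfTorus hq (by lia)
  have hcenter := zetaTrace_halfTorus_mul hq (by lia)
  rw [hsign] at hhalf hcenter
  have hm : (q - 1) / 4 = halfTorus q := by lia
  have hsum1 := zetaSum_eq_zetaTrace_half (n := q - 1) (m := torusOrder q 1) (by lia)
  have hsum2 := zetaSum_eq_zetaTrace_half (n := q + 1) (m := torusOrder q (-1)) (by lia)
  have hk (k : Finset.Icc 1 2) : (k : ℕ) - 1 + 1 = (k : ℕ) :=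
    Nat.sub_add_cancel (Finset.mem_Icc.1 k.2).1
  have hne : (1 : ℤˣ) ≠ -1 := by decide
  rcases i with _ | c | c | _ | c <;> rcases s with _ | k | k | _ | k <;>
    simp only [oneEntry, oneRowLabel, oneColLabel, character_half_one,
      character_half_unipotent, character_half_torus hq]
  all_goals
    simp [character, steinberg, seriesChar, hsum1, hsum2, hcenter, hsign, hm, gaussSum, h, hk, hne,
      hne.symm, pow_add, sub_eq_add_neg]

theorem isPassingEigentable_table (hq : 2 ≤ q)
    (hpass : (fusionRing hq).PassesOneSpectrumCriterion) :
    FusionRing.IsPassingEigentable (table q).entry := by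
  rcases Nat.mod_two_eq_zero_or_one q with h | hodd
  · rw [table, if_pos h]
    exact (verlindeData hq).isPassingEigentable_of_bijective (T' := evenEntry q) hpass
      (evenRowLabel_bijective hq h) (evenColLabel_bijective hq h) (evenEntry_eq hq h)
  by_cases h : q % 4 = 3
  · rw [table, if_neg (by lia), if_pos h]
    exact (verlindeData hq).isPassingEigentable_of_bijective (T' := threeEntry q) hpass
      (threeRowLabel_bijective hq h) (threeColLabel_bijective hq h) (threeEntry_eq hq h)
  · rw [table, if_neg (by lia), if_neg h]
    have h : q % 4 = 1 := by lia
    exact (verlindeData hq).isPassingEigentable_of_bijective (T' := oneEntry q) hpass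
      (oneRowLabel_bijective hq h) (oneColLabel_bijective hq h) (oneEntry_eq hq h)

end Tables

end InterpolatedPSL2

namespace FusionRing

variable {ι : Type*} [Fintype ι] [DecidableEq ι] (R : FusionRing ι)

theorem dual_dual (i : ι) : R.dual (R.dual i) = i := by
  have h := R.dual_left (R.dual i) i
  rw [R.dual_right, if_pos rfl] at h
  exact of_not_not fun hne => one_ne_zero (h.trans (if_neg (Ne.symm hne)))

theorem dual_one : R.dual R.one = R.one := by
  have h := R.dual_right R.one R.one
  rw [R.one_mul, if_pos rfl] at h
  exact of_not_not fun hne => one_ne_zero (h.trans (if_neg (Ne.symm hne)))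

theorem dual_ne_one {i : ι} (h : i ≠ R.one) : R.dual i ≠ R.one := fun hi =>
  h (by rw [← R.dual_dual i, hi, R.dual_one])

/-- The coefficient of the unit in the product of three basis elements. -/
def triple (i j k : ι) : ℕ := R.N i j (R.dual k)

/-- The coefficient of the unit in the product of four basis elements. -/
def fourfold (i j k l : ι) : ℕ := ∑ m, R.N i j m * R.triple m k l

theorem N_eq_triple (i j k : ι) : R.N i j k = R.triple i j (R.dual k) := by
  rw [triple, R.dual_dual]

theorem triple_rotate (i j k : ι) : R.triple i j k = R.triple j k i := by
  rw [triple, R.frobenius_left, R.frobenius_right, R.dual_dual, triple]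

namespace IsCommutative

variable {R} (hR : R.IsCommutative)

include hR

theorem triple_comm (i j k : ι) : R.triple i j k = R.triple j i k := hR i j _

theorem triple_right_comm (i j k : ι) : R.triple i j k = R.triple i k j := by
  rw [R.triple_rotate, hR.triple_comm, ← R.triple_rotate]

theorem triple_dual (i j k : ι) :
    R.triple (R.dual i) (R.dual j) (R.dual k) = R.triple i j k := by
  rw [← N_eq_triple, ← R.frobenius_left i k, ← triple, hR.triple_right_comm]

theorem fourfold_comm (i j k l : ι) : R.fourfold i j k l = R.fourfold j i k l := by
  simp only [fourfold, hR i j]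

theorem fourfold_right_comm (i j k l : ι) : R.fourfold i j k l = R.fourfold i j l k := by
  simp only [fourfold, hR.triple_right_comm _ k]

theorem fourfold_rotate (i j k l : ι) : R.fourfold i j k l = R.fourfold j k i l :=
  (R.assoc i j k _).trans (Finset.sum_congr rfl fun m _ => by rw [hR i, triple])

theorem fourfold_left_comm (i j k l : ι) : R.fourfold i j k l = R.fourfold i k j l := by
  rw [hR.fourfold_rotate, hR.fourfold_comm, ← hR.fourfold_rotate]

theorem fourfold_swap (i j k l : ι) : R.fourfold i j k l = R.fourfold k l i j := by
  rw [hR.fourfold_left_comm, hR.fourfold_comm, hR.fourfold_right_comm, hR.fourfold_left_comm]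

theorem fourfold_dual (i j k l : ι) :
    R.fourfold (R.dual i) (R.dual j) (R.dual k) (R.dual l) = R.fourfold i j k l := by
  let e : ι ≃ ι := Function.Involutive.toPerm R.dual R.dual_dual
  have he (m : ι) : e m = R.dual m := rfl
  simp only [fourfold, N_eq_triple]
  rw [← e.sum_comp]
  simp only [he, hR.triple_dual]

theorem pairSum_eq_fourfold (i j k l : ι) :
    R.pairSum i j k l = R.fourfold i j (R.dual k) (R.dual l) := by
  refine Finset.sum_congr rfl fun m _ => ?_
  rw [R.N_eq_triple k, ← hR.triple_dual k, R.dual_dual, ← R.triple_rotate]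

end IsCommutative

section Prisms

/-- The nontrivial basis elements `a` and `a'` multiply to `J` with multiplicity one. -/
def IsSpoke (J a a' : ι) : Prop := a ≠ R.one ∧ a' ≠ R.one ∧ R.N a a' J = 1

/-- The conditions of the one spectrum criterion on the index `x` joining the pairs `(a, a')` and
`(b, b')`. -/
def IsLink (J a a' b b' x : ι) : Prop :=
  R.triple (R.dual a) b x ≠ 0 ∧ R.triple a' (R.dual b') x ≠ 0 ∧
    (R.fourfold a a' (R.dual b) (R.dual b') = 1 ∨ R.fourfold x (R.dual a) (R.dual b') J = 1 ∨
      R.fourfold b x (R.dual J) a' = 1)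

instance (J a a' : ι) : Decidable (R.IsSpoke J a a') := by unfold IsSpoke; infer_instance

instance (J a a' b b' x : ι) : Decidable (R.IsLink J a a' b b' x) := by
  unfold IsLink; infer_instance

/-- The one spectrum system in a form that is symmetric under rotation: three pairs with `J` as
their only common constituent, joined cyclically by links `x`, `y`, `z` whose triple product
vanishes. -/
structure IsPrism (J a a' b b' c c' : ι) : Prop where
  spoke_a : R.IsSpoke J a a'
  spoke_b : R.IsSpoke J b b'
  spoke_c : R.IsSpoke J c c'
  eq_zero : ∀ l, l ≠ J → R.N a a' l * R.N b b' l * R.N c c' l = 0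
  exists_links : ∃ x y z, R.IsLink J a a' b b' x ∧ R.IsLink J b b' c c' y ∧
    R.IsLink J c c' a a' z ∧ R.triple x y z = 0

variable {R} {J a a' b b' c c' : ι}

theorem IsPrism.rotate (h : R.IsPrism J a a' b b' c c') : R.IsPrism J b b' c c' a a' where
  spoke_a := h.spoke_b
  spoke_b := h.spoke_c
  spoke_c := h.spoke_a
  eq_zero l hl := by rw [← h.eq_zero l hl]; ring
  exists_links := by
    obtain ⟨x, y, z, hx, hy, hz, h0⟩ := h.exists_links
    exact ⟨y, z, x, hy, hz, hx, by rwa [← R.triple_rotate]⟩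

theorem IsPrism.eq_of_ne_zero (h : R.IsPrism J a a' b b' c c') {l : ι} (ha : R.N a a' l ≠ 0)
    (hb : R.N b b' l ≠ 0) (hc : R.N c c' l ≠ 0) : l = J :=
  of_not_not fun hl => mul_ne_zero (mul_ne_zero ha hb) hc (h.eq_zero l hl)

theorem IsPrism.exists_N_eq_zero (h : R.IsPrism J a a' b b' c c') {l : ι} (hl : l ≠ J) :
    ∃ a a' b b' c c', R.IsPrism J a a' b b' c c' ∧ R.N a a' l = 0 := by
  obtain h0 | h0 := mul_eq_zero.1 (h.eq_zero l hl)
  · obtain h0 | h0 := mul_eq_zero.1 h0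
    · exact ⟨_, _, _, _, _, _, h, h0⟩
    · exact ⟨_, _, _, _, _, _, h.rotate, h0⟩
  · exact ⟨_, _, _, _, _, _, h.rotate.rotate, h0⟩

theorem IsLink.eq_of_one (h : R.IsLink J a a' b b' R.one) : b = a ∧ b' = a' := by
  obtain ⟨h, h', -⟩ := h
  simp only [triple, R.dual_one, R.dual_right, R.dual_dual, ne_eq, ite_eq_right_iff, one_ne_zero,
    imp_false, not_not] at h h'
  exact ⟨h, by rw [← R.dual_dual b', h', R.dual_dual]⟩

theorem fourfold_ne_one {i j k l m n : ι} (hmn : m ≠ n) (hm : R.N i j m ≠ 0)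
    (hm' : R.triple m k l ≠ 0) (hn : R.N i j n ≠ 0) (hn' : R.triple n k l ≠ 0) :
    R.fourfold i j k l ≠ 1 := by
  have hle := Finset.add_le_sum (s := Finset.univ)
    (f := fun m => R.N i j m * R.triple m k l) (fun _ _ => Nat.zero_le _)
    (Finset.mem_univ m) (Finset.mem_univ n) hmn
  have := Nat.mul_ne_zero hm hm'
  have := Nat.mul_ne_zero hn hn'
  simp only [fourfold] at hle ⊢
  lia

/-- The pair `(a, a')` belongs to a prism; the conditions are nested for an exhaustive search. -/
def ExtendsToPrism (R : FusionRing ι) (J a a' : ι) : Prop :=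
  R.IsSpoke J a a' ∧ ∃ b b', R.IsSpoke J b b' ∧ ∃ c c', R.IsSpoke J c c' ∧
    (∀ l, l ≠ J → R.N a a' l * R.N b b' l * R.N c c' l = 0) ∧
    ∃ x, R.IsLink J a a' b b' x ∧ ∃ y, R.IsLink J b b' c c' y ∧
      ∃ z, R.IsLink J c c' a a' z ∧ R.triple x y z = 0

instance (J a a' : ι) : Decidable (R.ExtendsToPrism J a a') := by
  unfold ExtendsToPrism; infer_instance

theorem IsPrism.extendsToPrism (h : R.IsPrism J a a' b b' c c') : R.ExtendsToPrism J a a' := by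
  obtain ⟨x, y, z, hx, hy, hz, h0⟩ := h.exists_links
  exact ⟨h.spoke_a, b, b', h.spoke_b, c, c', h.spoke_c, h.eq_zero, x, hx, y, hy, z, hz, h0⟩

theorem OneSpectrumSystem.isPrism (hR : R.IsCommutative) {i₀ i₁ i₂ i₃ i₄ i₅ i₆ i₇ i₈ i₉ : ι}
    (h : R.OneSpectrumSystem i₀ i₁ i₂ i₃ i₄ i₅ i₆ i₇ i₈ i₉) :
    R.IsPrism i₀ i₄ i₇ (R.dual i₅) i₈ i₆ (R.dual i₉) := by
  obtain ⟨h4, h5, h6, h7, h8, h9⟩ := h.ne_one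
  obtain ⟨⟨h416, h542, h563, h791, h278, h893⟩, hsum, ⟨h470, h580, h690⟩, h213, hx, hy, hz⟩ := h
  simp only [hR.pairSum_eq_fourfold, R.dual_dual] at hx hy hz
  refine ⟨⟨h4, h7, h470⟩, ⟨R.dual_ne_one h5, h8, h580⟩, ⟨h6, R.dual_ne_one h9, h690⟩, ?_,
    i₂, R.dual i₃, i₁, ⟨?_, ?_, ?_⟩, ⟨?_, ?_, ?_⟩, ⟨?_, ?_, ?_⟩, ?_⟩
  · intro l hl
    rw [← Finset.add_sum_erase _ _ (Finset.mem_univ i₀), h470, h580, h690] at hsum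
    exact Finset.sum_eq_zero_iff.1 (Nat.add_left_cancel hsum) l (by simpa using hl)
  · rwa [hR.triple_comm, ← hR.triple_dual, R.dual_dual, R.dual_dual, ← N_eq_triple]
  · rwa [← R.triple_rotate, ← N_eq_triple]
  · simp only [R.dual_dual, hR.fourfold_comm, hR.fourfold_left_comm,
      hR.fourfold_right_comm] at hx ⊢
    tauto
  · rwa [R.dual_dual, ← N_eq_triple]
  · rwa [R.dual_dual, ← N_eq_triple]
  · simp only [R.dual_dual, hR.fourfold_comm, hR.fourfold_left_comm,
      hR.fourfold_right_comm] at hy ⊢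
    tauto
  · rwa [R.triple_rotate, ← N_eq_triple]
  · rwa [hR.triple_comm, ← hR.triple_dual, R.dual_dual, R.dual_dual, ← N_eq_triple]
  · rw [← hR.fourfold_dual i₆, ← hR.fourfold_dual i₄]
    simp only [R.dual_dual, hR.fourfold_comm, hR.fourfold_left_comm,
      hR.fourfold_right_comm] at hz ⊢
    tauto
  · rwa [hR.triple_right_comm, ← N_eq_triple]

theorem passesOneSpectrumCriterion_of_not_isPrism (hR : R.IsCommutative)
    (h : ∀ J a a' b b' c c', ¬ R.IsPrism J a a' b b' c c') : R.PassesOneSpectrumCriterion :=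
  fun _ _ _ _ _ _ _ _ _ _ hsys => h _ _ _ _ _ _ _ (hsys.isPrism hR)

end Prisms

end FusionRing

namespace InterpolatedPSL2

section CommonConstituents

variable {q : ℕ} {a a' b b' l : CharLabel q}

open CharLabel

/-- Both characters are halves of the reducible series member, with signs of product `ε`. Only such
pairs fail to have nearly all irreducible characters as constituents of their product. -/
inductive IsHalfPair (ε : ℤˣ) : CharLabel q → CharLabel q → Prop
  | intro (h : q % 2 = 1) (σ τ : ℤˣ) (hε : σ * τ = ε) : IsHalfPair ε (half h σ) (half h τ)

theorem IsHalfPair.exists_eq (h : IsHalfPair 1 a a') :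
    ∃ h σ, a = half h σ ∧ a' = half h σ := by
  obtain ⟨h, σ, τ, hστ⟩ := h
  obtain rfl : τ = σ := (eq_inv_of_mul_eq_one_right hστ).trans (Int.units_inv_eq_self σ)
  exact ⟨h, _, rfl, rfl⟩

theorem IsHalfPair.dual {ε : ℤˣ} (h : IsHalfPair ε a a') : IsHalfPair ε a.dual a'.dual := by
  obtain ⟨h, σ, τ, rfl⟩ := h
  have hmul : ∀ s σ τ : ℤˣ, s * σ * (s * τ) = σ * τ := by decide
  exact .intro h _ _ (hmul _ σ τ)

theorem IsHalfPair.exists_dual {ε : ℤˣ} (ha : IsHalfPair ε a a') (hb : IsHalfPair (-ε) b b') :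
    ∃ δ, IsHalfPair δ a.dual b ∧ IsHalfPair (-δ) a' b'.dual := by
  obtain ⟨h, σ, σ', ha⟩ := ha
  obtain ⟨-, τ, τ', hb⟩ := hb
  have hmul : ∀ ε s σ σ' τ τ' : ℤˣ, σ * σ' = ε → τ * τ' = -ε →
      σ' * (s * τ') = -(s * σ * τ) := by decide
  exact ⟨_, .intro h _ _ rfl, .intro h _ _ (hmul ε _ σ σ' τ τ' ha hb)⟩

theorem IsHalfPair.multiplicity_series_ne_zero {ε : ℤˣ} {x}
    (h : IsHalfPair (evenTorusSign q * ε) a a') : multiplicity a a' (series ε x) ≠ 0 := by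
  obtain ⟨-, σ, τ, h⟩ := h
  have hε : evenTorusSign q * (evenTorusSign q * ε) = ε := by
    rw [← mul_assoc, Int.units_mul_self, one_mul]
  exact ne_of_eq_of_ne (if_pos (by rw [h, hε])) one_ne_zero

theorem eq_st_of_isHalfPair {ε : ℤˣ} (ha : IsHalfPair ε a a') (hb : IsHalfPair (-ε) b b')
    (hal : multiplicity a a' l ≠ 0) (hbl : multiplicity b b' l ≠ 0) :
    q % 4 = 1 ∧ l = st := by
  obtain ⟨h, σ, σ', ha⟩ := ha
  obtain ⟨_, τ, τ', hb⟩ := hb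
  have hneg : ∀ s : ℤˣ, s ≠ -s := by decide
  have hmul : ∀ s σ : ℤˣ, σ * (s * σ) = s := by decide
  have hst : evenTorusSign q = 1 → q % 4 = 1 := by unfold evenTorusSign; grind
  rcases l with _ | _ | ⟨ε', x⟩ | ⟨_, υ⟩ <;> simp only [multiplicity, dual] at * <;> grind

theorem multiplicity_st_ne_zero (hq : q % 4 = 1) (ha : a ≠ triv) (ha' : a' ≠ triv) :
    multiplicity a a' st ≠ 0 := by
  have hsign : evenTorusSign q = 1 := if_pos hq
  have hcenter : centerOrder q = 2 := centerOrder_of_odd (by lia)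
  rcases a with _ | _ | ⟨ε, x⟩ | ⟨h, σ⟩ <;> rcases a' with _ | _ | ⟨ε', y⟩ | ⟨h', τ⟩ <;>
    simp only [multiplicity, addUnitIf] <;> grind

theorem isHalfPair_of_multiplicity_principal_eq_zero {x} (ha : a ≠ triv) (ha' : a' ≠ triv)
    (h : multiplicity a a' (series 1 x) = 0) : IsHalfPair (-evenTorusSign q) a a' := by
  have hcenter := centerOrder_ne_zero q
  have hsign : ∀ s t : ℤˣ, 1 ≠ s * t → t = -s := by decide
  rcases a with _ | _ | ⟨ε, y⟩ | ⟨h, σ⟩ <;> rcases a' with _ | _ | ⟨ε', z⟩ | ⟨h', τ⟩ <;>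
    simp only [multiplicity, addUnitIf] at h <;> grind [IsHalfPair.intro]

theorem isHalfPair_of_multiplicity_discrete_eq_zero (hq : q % 2 = 1) {y y'} (hy : y ≠ y')
    (ha : a ≠ triv) (ha' : a' ≠ triv) (h : multiplicity a a' (series (-1) y) = 0)
    (h' : multiplicity a a' (series (-1) y') = 0) : IsHalfPair (evenTorusSign q) a a' := by
  have hcenter : centerOrder q = 2 := centerOrder_of_odd hq
  have hsign : ∀ s t : ℤˣ, -1 ≠ s * t → t = s := by decide
  rcases a with _ | _ | ⟨ε, x⟩ | ⟨h, σ⟩ <;> rcases a' with _ | _ | ⟨ε', z⟩ | ⟨h', τ⟩ <;>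
    simp only [multiplicity, addUnitIf] at h h' <;> grind [IsHalfPair.intro]

theorem isHalfPair_of_multiplicity_discrete_eq_zero_of_mod_four (hq : q % 4 = 1) {y}
    (ha : a ≠ triv) (ha' : a' ≠ triv) (h : multiplicity a a' (series (-1) y) = 0) :
    IsHalfPair (evenTorusSign q) a a' := by
  have hcenter : centerOrder q = 2 := centerOrder_of_odd (by lia)
  have hpos : evenTorusSign q = 1 := if_pos hq
  have hsign : ∀ s t : ℤˣ, -1 ≠ s * t → t = s := by decide
  rcases a with _ | _ | ⟨ε, x⟩ | ⟨h, σ⟩ <;> rcases a' with _ | _ | ⟨ε', z⟩ | ⟨h', τ⟩ <;>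
    simp only [multiplicity, addUnitIf] at h <;> grind [IsHalfPair.intro]

end CommonConstituents

section Prisms

variable {q : ℕ} {hq : 2 ≤ q} {J a a' b b' c c' : CharLabel q}

open CharLabel FusionRing

theorem isCommutative_fusionRing (hq : 2 ≤ q) : (fusionRing hq).IsCommutative :=
  fun a b _ => multiplicity_comm a b _

theorem triple_fusionRing (hq : 2 ≤ q) (a b c : CharLabel q) :
    (fusionRing hq).triple a b c = multiplicity a b c :=
  congrArg (multiplicity a b) c.dual_dual

theorem exists_ne_principal (h : 5 ≤ torusOrder q 1) :
    ∃ x x' : Finset.Icc 1 ((torusOrder q 1 - 1) / 2), x ≠ x' :=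
  ⟨⟨1, Finset.mem_Icc.2 (by lia)⟩, ⟨2, Finset.mem_Icc.2 (by lia)⟩, by simp⟩

theorem eq_principal_or_exists_isHalfPair (h : (fusionRing hq).IsPrism J a a' b b' c c') (x) :
    J = series 1 x ∨ ∃ a a' b b' c c', (fusionRing hq).IsPrism J a a' b b' c c' ∧
      IsHalfPair (-evenTorusSign q) a a' := by
  by_cases hx : series 1 x = J
  · exact .inl hx.symm
  · obtain ⟨a, a', b, b', c, c', h, h0⟩ := h.exists_N_eq_zero hx
    exact .inr ⟨a, a', b, b', c, c', h,
      isHalfPair_of_multiplicity_principal_eq_zero h.spoke_a.1 h.spoke_a.2.1 h0⟩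

theorem eq_principal_of_even (h : (fusionRing hq).IsPrism J a a' b b' c c') (heven : q % 2 = 0)
    (x) : J = series 1 x := by
  obtain hJ | ⟨a, a', _, _, _, _, -, ⟨hodd, -, -, -⟩⟩ := eq_principal_or_exists_isHalfPair h x
  · exact hJ
  · lia

theorem not_isHalfPair_of_isHalfPair {ε : ℤˣ} (h : (fusionRing hq).IsPrism J a a' b b' c c')
    (hmod : q % 4 ≠ 1) (ha : IsHalfPair ε a a') : ¬ IsHalfPair (-ε) b b' := fun hb =>
  hmod (eq_st_of_isHalfPair ha hb (ne_of_eq_of_ne h.spoke_a.2.2 one_ne_zero)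
    (ne_of_eq_of_ne h.spoke_b.2.2 one_ne_zero)).1

section OneModFour

theorem eq_st (h : (fusionRing hq).IsPrism J a a' b b' c c') (hmod : q % 4 = 1) : J = st :=
  (h.eq_of_ne_zero (l := st) (multiplicity_st_ne_zero hmod h.spoke_a.1 h.spoke_a.2.1)
    (multiplicity_st_ne_zero hmod h.spoke_b.1 h.spoke_b.2.1)
    (multiplicity_st_ne_zero hmod h.spoke_c.1 h.spoke_c.2.1)).symm

theorem eq_st_of_isLink {ε : ℤˣ} {x} (ha : IsHalfPair ε a a') (hb : IsHalfPair (-ε) b b')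
    (hx : (fusionRing hq).IsLink J a a' b b' x) : q % 4 = 1 ∧ x = st := by
  obtain ⟨δ, hδ, hδ'⟩ := ha.exists_dual hb
  refine eq_st_of_isHalfPair hδ hδ' ?_ ?_
  · exact triple_fusionRing hq .. ▸ hx.1
  · exact triple_fusionRing hq .. ▸ hx.2.1

theorem not_isPrism_of_isHalfPair {ε : ℤˣ} (ha : IsHalfPair ε a a') (hb : IsHalfPair (-ε) b b') :
    ¬ (fusionRing hq).IsPrism J a a' b b' c c' := by
  intro h
  obtain ⟨x, y, z, hx, hy, hz, h0⟩ := h.exists_links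
  obtain ⟨hmod, rfl⟩ := eq_st_of_isLink ha hb hx
  rw [triple_rotate, triple_fusionRing] at h0
  by_cases hy1 : y = triv
  · subst hy1
    obtain ⟨rfl, rfl⟩ := IsLink.eq_of_one hy
    obtain ⟨-, rfl⟩ := eq_st_of_isLink hb (by rwa [neg_neg]) hz
    exact one_ne_zero h0
  by_cases hz1 : z = triv
  · subst hz1
    obtain ⟨rfl, rfl⟩ := IsLink.eq_of_one hz
    obtain ⟨-, rfl⟩ := eq_st_of_isLink hb (by rwa [neg_neg]) hy
    exact one_ne_zero h0
  exact multiplicity_st_ne_zero hmod hy1 hz1 h0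

theorem not_isPrism_of_nine_le (hmod : q % 4 = 1) (hle : 9 ≤ q) :
    ¬ (fusionRing hq).IsPrism J a a' b b' c c' := by
  intro h
  have hcard (ε) : 3 ≤ torusOrder q ε := le_torusOrder hq (by lia) ε
  have index (ε) : Finset.Icc 1 ((torusOrder q ε - 1) / 2) :=
    ⟨1, Finset.mem_Icc.2 (by grind)⟩
  obtain rfl := eq_st h hmod
  obtain h1 | ⟨a, a', b, b', c, c', h, ha⟩ := eq_principal_or_exists_isHalfPair h (index 1)
  · exact nomatch h1
  have ha0 : (fusionRing hq).N a a' (series (-1) (index (-1))) ≠ 0 :=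
    IsHalfPair.multiplicity_series_ne_zero (by rwa [mul_neg_one])
  have h0 := h.eq_zero (series (-1) (index (-1))) nofun
  rw [mul_assoc, mul_eq_zero, or_iff_right ha0, mul_eq_zero] at h0
  obtain hb | hc := h0
  · refine not_isPrism_of_isHalfPair ha ?_ h
    rw [neg_neg]
    exact isHalfPair_of_multiplicity_discrete_eq_zero_of_mod_four hmod
      h.spoke_b.1 h.spoke_b.2.1 hb
  · exact not_isPrism_of_isHalfPair (isHalfPair_of_multiplicity_discrete_eq_zero_of_mod_four hmod
      h.spoke_c.1 h.spoke_c.2.1 hc) ha h.rotate.rotate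

end OneModFour

section ThreeModFour

theorem exists_ne_discrete (hodd : q % 2 = 1) (h7 : 7 ≤ torusOrder q (-1)) (ha : a ≠ triv)
    (ha' : a' ≠ triv) (h : ¬ IsHalfPair (evenTorusSign q) a a') :
    ∃ y y', y ≠ y' ∧ multiplicity a a' (series (-1) y) ≠ 0 ∧
      multiplicity a a' (series (-1) y') ≠ 0 := by
  let y (i : Fin 3) : Finset.Icc 1 ((torusOrder q (-1) - 1) / 2) :=
    ⟨i + 1, Finset.mem_Icc.2 (by lia)⟩
  have hy (i j : Fin 3) (hij : i ≠ j) : y i ≠ y j := by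
    simpa [y, Fin.val_inj] using hij
  have hvanish (i j) (hij : i ≠ j) (hi : multiplicity a a' (series (-1) (y i)) = 0) :
      multiplicity a a' (series (-1) (y j)) ≠ 0 := fun hj =>
    h (isHalfPair_of_multiplicity_discrete_eq_zero hodd (hy i j hij) ha ha' hi hj)
  by_cases h0 : multiplicity a a' (series (-1) (y 0)) = 0
  · exact ⟨_, _, hy 1 2 (by decide), hvanish 0 1 (by decide) h0, hvanish 0 2 (by decide) h0⟩
  by_cases h1 : multiplicity a a' (series (-1) (y 1)) = 0
  · exact ⟨_, _, hy 0 2 (by decide), h0, hvanish 1 2 (by decide) h1⟩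
  · exact ⟨_, _, hy 0 1 (by decide), h0, h1⟩

theorem IsHalfPair.N_discrete_ne_zero (ha : IsHalfPair 1 a a') (hmod : q % 4 = 3) (y) :
    (fusionRing hq).N a a' (series (-1) y) ≠ 0 :=
  IsHalfPair.multiplicity_series_ne_zero <| by rwa [evenTorusSign, if_neg (by lia)]

theorem fourfold_ne_one_of_isHalfPair (hmod : q % 4 = 3) (hle : 15 ≤ q) (ha : IsHalfPair 1 a a')
    (hb : b ≠ triv) (hb' : b' ≠ triv) (hbb' : ¬ IsHalfPair (evenTorusSign q) b b') :
    (fusionRing hq).fourfold a a' b b' ≠ 1 := by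
  obtain ⟨y, y', hy, hby, hby'⟩ :=
    exists_ne_discrete (by lia) (le_torusOrder hq hle (-1)) hb hb' hbb'
  have htriple {y} (h : multiplicity b b' (series (-1) y) ≠ 0) :
      (fusionRing hq).triple (series (-1) y) b b' ≠ 0 := by
    rwa [triple_rotate, triple_fusionRing]
  exact fourfold_ne_one (by simpa using hy) (ha.N_discrete_ne_zero hmod y) (htriple hby)
    (ha.N_discrete_ne_zero hmod y') (htriple hby')

theorem fourfold_discrete_ne_one (hmod : q % 4 = 3) (hle : 15 ≤ q) (ha : a ≠ triv) (hb : b ≠ triv)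
    (hc : c ≠ triv) (y) : (fusionRing hq).fourfold a b c (series (-1) y) ≠ 1 := by
  have hsign : evenTorusSign q = -1 := if_neg (by lia)
  by_cases hab : IsHalfPair 1 a b
  · exact fourfold_ne_one_of_isHalfPair hmod hle hab hc nofun nofun
  obtain ⟨x, x', hx⟩ := exists_ne_principal (le_torusOrder hq (by lia) 1)
  have hN (x) : (fusionRing hq).N a b (series 1 x) ≠ 0 := fun h0 => hab <| by
    simpa [hsign] using isHalfPair_of_multiplicity_principal_eq_zero ha hb h0
  have htriple (x) : (fusionRing hq).triple (series 1 x) c (series (-1) y) ≠ 0 := by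
    rw [triple_rotate, triple_fusionRing]
    intro h0
    exact nomatch isHalfPair_of_multiplicity_principal_eq_zero hc (nofun : series (-1) y ≠ triv) h0
  exact fourfold_ne_one (by simpa using hx) (hN x) (htriple x) (hN x') (htriple x')

theorem exists_eq_discrete (hmod : q % 4 = 3) (hle : 15 ≤ q)
    (h : (fusionRing hq).IsPrism J a a' b b' c c') (ha : IsHalfPair 1 a a')
    (hb : ¬ IsHalfPair (evenTorusSign q) b b') (hc : ¬ IsHalfPair (evenTorusSign q) c c') :
    ∃ y y', J = series (-1) y' ∧ (fusionRing hq).N c c' (series (-1) y) = 0 := by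
  have hay := ha.N_discrete_ne_zero (hq := hq) hmod
  obtain ⟨y, y', hy, hby, hby'⟩ := exists_ne_discrete (by lia) (le_torusOrder hq hle (-1))
    h.spoke_b.1 h.spoke_b.2.1 hb
  by_cases hcy : (fusionRing hq).N c c' (series (-1) y) = 0
  · exact ⟨y, y', (h.eq_of_ne_zero (hay y') hby' fun hcy' =>
      hc (isHalfPair_of_multiplicity_discrete_eq_zero (by lia) hy h.spoke_c.1 h.spoke_c.2.1
        hcy hcy')).symm, hcy⟩
  · obtain rfl := h.eq_of_ne_zero (hay y) hby hcy
    refine ⟨y', y, rfl, of_not_not fun hcy' => hy ?_⟩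
    simpa using (h.eq_of_ne_zero (hay y') hby' hcy').symm

theorem not_isPrism_of_fifteen_le (hmod : q % 4 = 3) (hle : 15 ≤ q) (ha : IsHalfPair 1 a a') :
    ¬ (fusionRing hq).IsPrism J a a' b b' c c' := by
  intro h
  have hsign : evenTorusSign q = -1 := if_neg (by lia)
  have hb : ¬ IsHalfPair (evenTorusSign q) b b' := fun hb =>
    not_isHalfPair_of_isHalfPair h (by lia) ha (by rwa [← hsign])
  have hc : ¬ IsHalfPair (evenTorusSign q) c c' := fun hc =>
    not_isHalfPair_of_isHalfPair h.rotate.rotate (by lia) hc (by rwa [hsign, neg_neg])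
  obtain ⟨y, y', rfl, hcy⟩ := exists_eq_discrete hmod hle h ha hb hc
  obtain ⟨-, -, z, -, -, hz, -⟩ := h.exists_links
  have hz1 : z ≠ triv := by
    rintro rfl
    obtain ⟨rfl, rfl⟩ := IsLink.eq_of_one hz
    exact ha.N_discrete_ne_zero hmod y hcy
  have hR := isCommutative_fusionRing hq
  obtain ⟨-, -, h1 | h1 | h1⟩ := hz
  · rw [hR.fourfold_swap] at h1
    exact fourfold_ne_one_of_isHalfPair hmod hle ha.dual h.spoke_c.1 h.spoke_c.2.1 hc h1
  · exact fourfold_discrete_ne_one hmod hle hz1 (dual_ne_one _ h.spoke_c.1)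
      (dual_ne_one _ h.spoke_a.2.1) y' h1
  · rw [hR.fourfold_right_comm] at h1
    exact fourfold_discrete_ne_one hmod hle h.spoke_a.1 hz1 h.spoke_c.2.1 y' h1

end ThreeModFour

end Prisms

section SmallParameters

open CharLabel FusionRing

theorem not_extendsToPrism_two :
    ∀ J a a', ¬ (fusionRing (q := 2) (by decide)).ExtendsToPrism J a a' := by
  decide +kernel

theorem not_extendsToPrism_three :
    ∀ J a a', ¬ (fusionRing (q := 3) (by decide)).ExtendsToPrism J a a' := by
  decide +kernel

theorem not_extendsToPrism_principal_four :
    ∀ x a a', ¬ (fusionRing (q := 4) (by decide)).ExtendsToPrism (series 1 x) a a' := by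
  decide +kernel

theorem not_extendsToPrism_st_five :
    ∀ a a', ¬ (fusionRing (q := 5) (by decide)).ExtendsToPrism st a a' := by
  decide +kernel

theorem not_extendsToPrism_principal_seven :
    ∀ x a a', ¬ (fusionRing (q := 7) (by decide)).ExtendsToPrism (series 1 x) a a' := by
  decide +kernel

theorem not_extendsToPrism_half_seven : ∀ J h σ,
    ¬ (fusionRing (q := 7) (by decide)).ExtendsToPrism J (half h σ) (half h σ) := by
  decide +kernel

theorem not_extendsToPrism_half_eleven : ∀ J h σ,
    ¬ (fusionRing (q := 11) (by decide)).ExtendsToPrism J (half h σ) (half h σ) := by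
  decide +kernel

end SmallParameters

section OneSpectrumCriterion

variable {q : ℕ} {J a a' b b' c c' : CharLabel q}

open CharLabel

theorem not_isPrism_of_even (hq : 2 ≤ q) (h : q % 2 = 0) :
    ¬ (fusionRing hq).IsPrism J a a' b b' c c' := by
  intro hprism
  have hJ := eq_principal_of_even hprism h
  obtain rfl | rfl | hle : q = 2 ∨ q = 4 ∨ 6 ≤ q := by lia
  · exact not_extendsToPrism_two _ _ _ hprism.extendsToPrism
  · obtain rfl := hJ ⟨1, by decide⟩
    exact not_extendsToPrism_principal_four _ _ _ hprism.extendsToPrism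
  · obtain ⟨x, x', hx⟩ := exists_ne_principal (q := q) (by
      have := torusOrder_of_even hq h 1; push_cast at this; lia)
    simpa [hx] using (hJ x).symm.trans (hJ x')

theorem not_isPrism_of_mod_four_eq_one (hq : 2 ≤ q) (h : q % 4 = 1) :
    ¬ (fusionRing hq).IsPrism J a a' b b' c c' := by
  obtain rfl | hle : q = 5 ∨ 9 ≤ q := by lia
  · intro hprism
    obtain rfl := eq_st hprism h
    exact not_extendsToPrism_st_five _ _ hprism.extendsToPrism
  · exact not_isPrism_of_nine_le h hle

theorem not_isPrism_of_mod_four_eq_three (hq : 2 ≤ q) (h : q % 4 = 3) :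
    ¬ (fusionRing hq).IsPrism J a a' b b' c c' := by
  intro hprism
  have hsign : evenTorusSign q = -1 := if_neg (by lia)
  obtain rfl | rfl | hle : q = 3 ∨ q = 7 ∨ 11 ≤ q := by lia
  · exact not_extendsToPrism_three _ _ _ hprism.extendsToPrism
  · obtain rfl | ⟨a, a', b, b', c, c', hprism, ha⟩ :=
      eq_principal_or_exists_isHalfPair hprism ⟨1, by decide⟩
    · exact not_extendsToPrism_principal_seven _ _ _ hprism.extendsToPrism
    · obtain ⟨_, σ, rfl, rfl⟩ := IsHalfPair.exists_eq (by rwa [hsign, neg_neg] at ha)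
      exact not_extendsToPrism_half_seven _ _ _ hprism.extendsToPrism
  obtain ⟨x, hx⟩ : ∃ x, J ≠ series 1 x := by
    obtain ⟨x, x', hx⟩ := exists_ne_principal (le_torusOrder hq hle 1)
    by_contra! hJ
    simpa [hx] using (hJ x).symm.trans (hJ x')
  obtain ⟨a, a', b, b', c, c', hprism, ha⟩ :=
    (eq_principal_or_exists_isHalfPair hprism x).resolve_left hx
  rw [hsign, neg_neg] at ha
  obtain rfl | hle : q = 11 ∨ 15 ≤ q := by lia
  · obtain ⟨_, σ, rfl, rfl⟩ := ha.exists_eq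
    exact not_extendsToPrism_half_eleven _ _ _ hprism.extendsToPrism
  · exact not_isPrism_of_fifteen_le h hle ha hprism

theorem passesOneSpectrumCriterion_fusionRing (hq : 2 ≤ q) :
    (fusionRing hq).PassesOneSpectrumCriterion := by
  refine FusionRing.passesOneSpectrumCriterion_of_not_isPrism (isCommutative_fusionRing hq) ?_
  intro J a a' b b' c c'
  obtain h | h | h : q % 2 = 0 ∨ q % 4 = 1 ∨ q % 4 = 3 := by lia
  · exact not_isPrism_of_even hq h
  · exact not_isPrism_of_mod_four_eq_one hq h
  · exact not_isPrism_of_mod_four_eq_three hq h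

end OneSpectrumCriterion

end InterpolatedPSL2

/-- For every integer `q ≥ 2` the interpolated fusion ring `R_q` exists, is unique, and passes the
one spectrum criterion. -/
theorem proposition7p15 (q : ℕ) (hq : 2 ≤ q) :
    (∃! R : FusionRing (InterpolatedPSL2.table q).Row,
      InterpolatedPSL2.IsInterpolatedFusionRing q R) ∧
    ∀ R : FusionRing (InterpolatedPSL2.table q).Row,
      InterpolatedPSL2.IsInterpolatedFusionRing q R → R.PassesOneSpectrumCriterion :=
  InterpolatedPSL2.isPassingEigentable_table hq
    (InterpolatedPSL2.passesOneSpectrumCriterion_fusionRing hq)
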